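/- Let $\Bbbk$ be a field of characteristic $0$ and $H=\Bbbk[\partial]$. Let $V=V_0\oplus V_1$ be a finite-dimensional Novikov superalgebra over $\Bbbk$, i.e. a $\mathbb Z_2$-graded space with an even bilinear product $\circ$ such that $$(a\circ b)\circ c=(-1)^{|b||c|}(a\circ c)\circ b,\qquad (a\circ b)\circ c-a\circ(b\circ c)=(-1)^{|a||b|}\big((b\circ a)\circ c-b\circ(a\circ c)\big)$$ for homogeneous $a,b,c\in V$. Regard $V$ as a Gelfand--Dorfman superalgebra with respect to the supercommutator $[a,b]=a\circ b-(-1)^{|a||b|}b\circ a$, and let $L(V)=H\otimes V$ be the corresponding quadratic Lie conformal superalgebra, whose $\lambda$-bracket is the sesquilinear map ($[\partial x{}_\lambda y]=-\lambda[x_\lambda y]$, $[x_\lambda\partial y]=(\partial+\lambda)[x_\lambda y]$) determined by $$[a_\lambda b]=[a,b]+(-1)^{|a||b|}\partial(b\circ a)+\lambda\big(a\circ b+(-1)^{|a||b|}b\circ a\big)$$ for homogeneous $a,b\in V$. Then $L(V)$ has a finite faithful representation: there are a finitely generated $\mathbb Z_2$-graded $H$-module $M$ and a $\Bbbk$-bilinear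 map $\rho_\lambda(\cdot,\cdot):L(V)\times M\to M[\lambda]$ which respects the gradings and satisfies $$\rho_\lambda(\partial a,x)=-\lambda\rho_\lambda(a,x),\qquad \rho_\lambda(a,\partial x)=(\partial+\lambda)\rho_\lambda(a,x),$$ $$\rho_\lambda(a,\rho_\mu(b,x))-(-1)^{|a||b|}\rho_\mu(b,\rho_\lambda(a,x))=\rho_{\lambda+\mu}([a_\lambda b],x)$$ for homogeneous $a,b\in L(V)$ and all $x\in M$, and such that $\rho_\lambda(a,\cdot)=0$ only for $a=0$. -/

import Mathlib

open Polynomial TensorProduct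

universe u v w

/-- The sign `(-1) ^ (|a| |b|)` for homogeneous elements `a`, `b` of parities `i`, `j`. -/
def superSign (i j : ZMod 2) : ℤ := (-1) ^ (i.val * j.val)

theorem superSign_comm (i j : ZMod 2) : superSign i j = superSign j i := by
  simp [superSign, mul_comm]

theorem superSign_add_left (i j l : ZMod 2) :
    superSign (i + j) l = superSign i l * superSign j l := by
  revert i j l; decide

theorem superSign_add_right (i j l : ZMod 2) :
    superSign i (j + l) = superSign i j * superSign i l := by
  revert i j l; decide

theorem superSign_eq (i j : ZMod 2) : superSign i j = 1 ∨ superSign i j = -1 :=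
  neg_one_pow_eq_or ℤ _

/-- A Novikov superalgebra over `k`: a `ℤ/2`-graded space with an even bilinear product
which is right commutative and left symmetric in the graded sense. -/
structure NovikovSuperalgebra (k : Type u) (V : Type v) [Field k] [AddCommGroup V]
    [Module k V] where
  /-- The even part `grading 0` and the odd part `grading 1`. -/
  grading : ZMod 2 → Submodule k V
  isInternal : DirectSum.IsInternal grading
  /-- The Novikov product `a ∘ b`. -/
  mul : V →ₗ[k] V →ₗ[k] V
  mul_mem : ∀ {i j : ZMod 2} {a b : V}, a ∈ grading i → b ∈ grading j →
    mul a b ∈ grading (i + j)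
  right_comm : ∀ {i j l : ZMod 2} {a b c : V},
    a ∈ grading i → b ∈ grading j → c ∈ grading l →
    mul (mul a b) c = superSign j l • mul (mul a c) b
  left_symm : ∀ {i j l : ZMod 2} {a b c : V},
    a ∈ grading i → b ∈ grading j → c ∈ grading l →
    mul (mul a b) c - mul a (mul b c) =
      superSign i j • (mul (mul b a) c - mul b (mul a c))

/-- A Gelfand--Dorfman superalgebra: a Novikov superalgebra with a Lie superalgebra bracket on
the same graded space, the two operations being related by the (graded) compatibility identity. -/
structure GDSuperalgebra (k : Type u) (V : Type v) [Field k] [AddCommGroup V]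
    [Module k V] extends NovikovSuperalgebra k V where
  /-- The Lie superbracket `[a, b]`. -/
  bracket : V →ₗ[k] V →ₗ[k] V
  bracket_mem : ∀ {i j : ZMod 2} {a b : V}, a ∈ grading i → b ∈ grading j →
    bracket a b ∈ grading (i + j)
  bracket_skew : ∀ {i j : ZMod 2} {a b : V}, a ∈ grading i → b ∈ grading j →
    bracket a b = -(superSign i j • bracket b a)
  bracket_jacobi : ∀ {i j l : ZMod 2} {a b c : V},
    a ∈ grading i → b ∈ grading j → c ∈ grading l →
    bracket a (bracket b c) =
      bracket (bracket a b) c + superSign i j • bracket b (bracket a c)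
  compat : ∀ {i j l : ZMod 2} {a b c : V},
    a ∈ grading i → b ∈ grading j → c ∈ grading l →
    bracket a (mul b c)
      - (superSign i j * superSign i l * superSign j l) • bracket c (mul b a)
      + superSign i j • mul (bracket b a) c
      - (superSign i j * superSign i l) • mul (bracket b c) a
      - superSign i j • mul b (bracket a c) = 0

namespace NovikovSuperalgebra

variable {k : Type u} {V : Type v} [Field k] [AddCommGroup V] [Module k V]

/-- The projection of `V` onto its component of parity `i`. -/
noncomputable def proj (N : NovikovSuperalgebra k V) (i : ZMod 2) : V →ₗ[k] V :=
  (N.grading i).subtype ∘ₗ DirectSum.component k (ZMod 2) (fun i => N.grading i) i ∘ₗ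
    (LinearEquiv.ofBijective (DirectSum.coeLinearMap N.grading) N.isInternal).symm.toLinearMap

theorem proj_of_mem (N : NovikovSuperalgebra k V) {i : ZMod 2} {a : V} (ha : a ∈ N.grading i)
    (j : ZMod 2) : N.proj j a = if i = j then a else 0 := by
  have h : (LinearEquiv.ofBijective (DirectSum.coeLinearMap N.grading) N.isInternal).symm a
      = DirectSum.lof k (ZMod 2) (fun i => N.grading i) i ⟨a, ha⟩ := by
    rw [LinearEquiv.symm_apply_eq]
    exact (DirectSum.coeLinearMap_lof N.grading i ⟨a, ha⟩).symm
  simp only [proj, LinearMap.comp_apply, LinearEquiv.coe_coe, h]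
  split_ifs with hij
  · subst hij
    simp [DirectSum.component.lof_self]
  · simp [DirectSum.component.of, hij]

/-- The graded opposite product: the bilinear map equal to `(-1) ^ (|a| |b|) b ∘ a` on
homogeneous `a`, `b` (see `oppMul_of_mem`). -/
noncomputable def oppMul (N : NovikovSuperalgebra k V) : V →ₗ[k] V →ₗ[k] V :=
  ∑ i : ZMod 2, ∑ j : ZMod 2, superSign i j • N.mul.flip.compl₁₂ (N.proj i) (N.proj j)

theorem oppMul_of_mem (N : NovikovSuperalgebra k V) {i j : ZMod 2} {a b : V}
    (ha : a ∈ N.grading i) (hb : b ∈ N.grading j) :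
    N.oppMul a b = superSign i j • N.mul b a := by
  simp only [oppMul, LinearMap.sum_apply, LinearMap.smul_apply, LinearMap.compl₁₂_apply,
    LinearMap.flip_apply, N.proj_of_mem ha, N.proj_of_mem hb]
  rw [Finset.sum_eq_single i, Finset.sum_eq_single j]
  · simp
  · intro b _ hb'; simp [hb'.symm]
  · simp
  · intro b _ hb'; simp [hb'.symm]
  · simp

/-- The supercommutator `[a, b] = a ∘ b - (-1) ^ (|a| |b|) b ∘ a`. -/
noncomputable def commutator (N : NovikovSuperalgebra k V) : V →ₗ[k] V →ₗ[k] V :=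
  N.mul - N.oppMul

theorem commutator_of_mem (N : NovikovSuperalgebra k V) {i j : ZMod 2} {a b : V}
    (ha : a ∈ N.grading i) (hb : b ∈ N.grading j) :
    N.commutator a b = N.mul a b - superSign i j • N.mul b a := by
  simp [commutator, N.oppMul_of_mem ha hb]

theorem commutator_mem (N : NovikovSuperalgebra k V) {i j : ZMod 2} {a b : V}
    (ha : a ∈ N.grading i) (hb : b ∈ N.grading j) :
    N.commutator a b ∈ N.grading (i + j) := by
  rw [N.commutator_of_mem ha hb]
  exact sub_mem (N.mul_mem ha hb) (zsmul_mem (add_comm j i ▸ N.mul_mem hb ha) _)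

/-- The Gelfand--Dorfman superalgebra constructed from a Novikov superalgebra with respect to
the supercommutator. -/
noncomputable def commutatorGD (N : NovikovSuperalgebra k V) : GDSuperalgebra k V where
  toNovikovSuperalgebra := N
  bracket := N.commutator
  bracket_mem := N.commutator_mem
  bracket_skew := by
    intro i j a b ha hb
    rw [N.commutator_of_mem ha hb, N.commutator_of_mem hb ha]
    rw [superSign_comm j i]
    rcases superSign_eq i j with h | h <;> rw [h] <;> module
  bracket_jacobi := by
    intro i j l a b c ha hb hc
    rw [N.commutator_of_mem ha (N.commutator_mem hb hc),
      N.commutator_of_mem (N.commutator_mem ha hb) hc,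
      N.commutator_of_mem hb (N.commutator_mem ha hc),
      N.commutator_of_mem ha hb, N.commutator_of_mem hb hc, N.commutator_of_mem ha hc]
    have h1 := N.left_symm ha hb hc
    have h2 := congrArg ((superSign i j * superSign i l) • ·) (N.left_symm hb hc ha)
    have h3 := congrArg (superSign j l • ·) (N.left_symm ha hc hb)
    simp only [superSign_add_left, superSign_add_right, superSign_comm j i,
      map_sub, map_zsmul, LinearMap.sub_apply, LinearMap.smul_apply]
      at h1 h2 h3 ⊢
    rcases superSign_eq i j with hp | hp <;> rcases superSign_eq i l with hq | hq <;>
      rcases superSign_eq j l with hr | hr <;> simp only [hp, hq, hr] at h1 h2 h3 ⊢ <;>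
      linear_combination (norm := module) (-1 : ℤ) • h1 + h3 - h2
  compat := by
    intro i j l a b c ha hb hc
    rw [N.commutator_of_mem ha (N.mul_mem hb hc), N.commutator_of_mem hc (N.mul_mem hb ha),
      N.commutator_of_mem hb ha, N.commutator_of_mem hb hc, N.commutator_of_mem ha hc]
    have h1 := N.left_symm ha hb hc
    have h2 := congrArg ((superSign i j * superSign i l * superSign j l) • ·)
      (N.left_symm hc hb ha)
    have h3 := congrArg ((superSign i j * superSign i l) • ·) (N.right_comm hb hc ha)
    simp only [superSign_add_right, superSign_comm j i, superSign_comm l i,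
      superSign_comm l j, map_sub, map_zsmul, LinearMap.sub_apply, LinearMap.smul_apply]
      at h1 h2 h3 ⊢
    rcases superSign_eq i j with hp | hp <;> rcases superSign_eq i l with hq | hq <;>
      rcases superSign_eq j l with hr | hr <;> simp only [hp, hq, hr] at h1 h2 h3 ⊢ <;>
      linear_combination (norm := module) (-1 : ℤ) • h1 + h2 - h3

end NovikovSuperalgebra

/-! ### Conformal algebras

`H = k[∂]` is `k[X]`, and `∂` acts on an `H`-module as multiplication by `X`.
A polynomial in `λ` with coefficients in `M` is a finitely supported function `p : ℕ →₀ M`,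
`p n` being the coefficient of `λ ^ n`. -/

section Conformal

variable (k : Type u) [Field k]

/-- The operator `∂` on an `H`-module. -/
noncomputable def del (M : Type w) [AddCommGroup M] [Module k M] [Module k[X] M]
    [IsScalarTower k k[X] M] : Module.End k M :=
  Algebra.lsmul k k M (X : k[X])

variable {k}

/-- Substitution of a linear operator `T` for `λ`: `∑ₙ λ ^ n mₙ` goes to `∑ₙ T ^ n mₙ`. -/
noncomputable def lambdaSubst {M : Type w} [AddCommGroup M] [Module k M] (T : Module.End k M) :
    (ℕ →₀ M) →ₗ[k] M :=
  Finsupp.lsum k fun n => T ^ n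

/-- The value at `λ = α`: `∑ₙ λ ^ n mₙ` goes to `∑ₙ α ^ n mₙ`. -/
noncomputable def lambdaEval {M : Type w} [AddCommGroup M] [Module k M] (α : k) :
    (ℕ →₀ M) →ₗ[k] M :=
  lambdaSubst (α • (1 : Module.End k M))

end Conformal

/-- A Lie conformal superalgebra: a `ℤ/2`-graded `H`-module `L` with a `λ`-bracket
`[a_λ b] ∈ L[λ]`. The base field is to be infinite (below it has characteristic zero), so
identities between polynomials in `λ`, `μ` are stated for all values `λ = α`, `μ = β` in `k`. -/
structure LieConformalSuperalgebra (k : Type u) (L : Type w) [Field k] [AddCommGroup L]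
    [Module k L] [Module k[X] L] [IsScalarTower k k[X] L] where
  grading : ZMod 2 → Submodule k[X] L
  isInternal : DirectSum.IsInternal grading
  /-- The `λ`-bracket. -/
  bracket : L →ₗ[k] L →ₗ[k] (ℕ →₀ L)
  bracket_mem : ∀ {i j : ZMod 2} {a b : L}, a ∈ grading i → b ∈ grading j →
    ∀ n, bracket a b n ∈ grading (i + j)
  /-- `[∂a_λ b] = -λ [a_λ b]` -/
  bracket_del_left : ∀ (a b : L) (α : k),
    lambdaEval α (bracket (del k L a) b) = -(α • lambdaEval α (bracket a b))
  /-- `[a_λ ∂b] = (∂ + λ) [a_λ b]` -/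
  bracket_del_right : ∀ (a b : L) (α : k),
    lambdaEval α (bracket a (del k L b)) =
      del k L (lambdaEval α (bracket a b)) + α • lambdaEval α (bracket a b)
  /-- `[a_λ b] = -(-1) ^ (|a| |b|) [b_{-∂-λ} a]` -/
  skew : ∀ {i j : ZMod 2} {a b : L}, a ∈ grading i → b ∈ grading j → ∀ α : k,
    lambdaEval α (bracket a b) =
      -(superSign i j • lambdaSubst (-del k L - α • (1 : Module.End k L)) (bracket b a))
  /-- `[a_λ [b_μ c]] - (-1) ^ (|a| |b|) [b_μ [a_λ c]] = [[a_λ b]_{λ+μ} c]` -/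
  jacobi : ∀ {i j : ZMod 2} {a b : L}, a ∈ grading i → b ∈ grading j → ∀ (c : L) (α β : k),
    lambdaEval α (bracket a (lambdaEval β (bracket b c)))
        - superSign i j • lambdaEval β (bracket b (lambdaEval α (bracket a c))) =
      lambdaEval (α + β) (bracket (lambdaEval α (bracket a b)) c)

namespace LieConformalSuperalgebra

variable {k : Type u} {L : Type v} [Field k] [AddCommGroup L] [Module k L] [Module k[X] L]
  [IsScalarTower k k[X] L]

/-- A (conformal) representation of a Lie conformal superalgebra on a `ℤ/2`-graded `H`-module
`M`. -/
structure Representation (S : LieConformalSuperalgebra k L) (M : Type w) [AddCommGroup M]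
    [Module k M] [Module k[X] M] [IsScalarTower k k[X] M] where
  grading : ZMod 2 → Submodule k[X] M
  isInternal : DirectSum.IsInternal grading
  /-- The `λ`-action `ρ_λ(a, x) ∈ M[λ]`. -/
  act : L →ₗ[k] M →ₗ[k] (ℕ →₀ M)
  act_mem : ∀ {i j : ZMod 2} {a : L} {x : M}, a ∈ S.grading i → x ∈ grading j →
    ∀ n, act a x n ∈ grading (i + j)
  /-- `ρ_λ(∂a, x) = -λ ρ_λ(a, x)` -/
  act_del_left : ∀ (a : L) (x : M) (α : k),
    lambdaEval α (act (del k L a) x) = -(α • lambdaEval α (act a x))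
  /-- `ρ_λ(a, ∂x) = (∂ + λ) ρ_λ(a, x)` -/
  act_del_right : ∀ (a : L) (x : M) (α : k),
    lambdaEval α (act a (del k M x)) =
      del k M (lambdaEval α (act a x)) + α • lambdaEval α (act a x)
  /-- `ρ_λ(a, ρ_μ(b, x)) - (-1) ^ (|a| |b|) ρ_μ(b, ρ_λ(a, x)) = ρ_{λ+μ}([a_λ b], x)` -/
  jacobi : ∀ {i j : ZMod 2} {a b : L}, a ∈ S.grading i → b ∈ S.grading j →
    ∀ (x : M) (α β : k),
    lambdaEval α (act a (lambdaEval β (act b x)))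
        - superSign i j • lambdaEval β (act b (lambdaEval α (act a x))) =
      lambdaEval (α + β) (act (lambdaEval α (S.bracket a b)) x)

/-- A representation is faithful if only `0` acts as zero. -/
def Representation.IsFaithful {S : LieConformalSuperalgebra k L} {M : Type w} [AddCommGroup M]
    [Module k M] [Module k[X] M] [IsScalarTower k k[X] M] (ρ : S.Representation M) : Prop :=
  ∀ a : L, (∀ x : M, ρ.act a x = 0) → a = 0

/-- `S` has a finite faithful representation (FFR): a faithful representation on a finitely
generated `H`-module. -/
def HasFFR (S : LieConformalSuperalgebra k L) : Prop :=
  ∃ (M : Type (max u v)) (_ : AddCommGroup M) (_ : Module k M) (_ : Module k[X] M)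
    (_ : IsScalarTower k k[X] M) (ρ : S.Representation M),
    Module.Finite k[X] M ∧ ρ.IsFaithful

end LieConformalSuperalgebra

/-! ### Quadratic Lie conformal superalgebras -/

section Sesquilinear

variable {k : Type u} [Field k] {M : Type w} [AddCommGroup M] [Module k M]

/-- Multiplication by `λ` on `M[λ]`. -/
noncomputable def lambdaShift (k : Type u) (M : Type w) [Field k] [AddCommGroup M]
    [Module k M] : Module.End k (ℕ →₀ M) :=
  Finsupp.lmapDomain M k Nat.succ

/-- The operator `∂` acting on the coefficients of an element of `M[λ]`. -/
noncomputable def lambdaDel (k : Type u) (M : Type w) [Field k] [AddCommGroup M]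
    [Module k M] [Module k[X] M] [IsScalarTower k k[X] M] : Module.End k (ℕ →₀ M) :=
  Finsupp.mapRange.linearMap (del k M)

theorem lambdaSubst_single (T : Module.End k M) (n : ℕ) (m : M) :
    lambdaSubst T (Finsupp.single n m) = (T ^ n) m := by
  simp [lambdaSubst]

theorem lambdaSubst_shift (T : Module.End k M) (p : ℕ →₀ M) :
    lambdaSubst T (lambdaShift k M p) = T (lambdaSubst T p) := by
  induction p using Finsupp.induction_linear with
  | zero => simp
  | add p q hp hq => simp [hp, hq]
  | single n m => simp [lambdaShift, lambdaSubst_single, pow_succ']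

theorem lambdaSubst_del [Module k[X] M] [IsScalarTower k k[X] M] (T : Module.End k M)
    (hT : Commute T (del k M)) (p : ℕ →₀ M) :
    lambdaSubst T (lambdaDel k M p) = del k M (lambdaSubst T p) := by
  induction p using Finsupp.induction_linear with
  | zero => simp
  | add p q hp hq => simp [hp, hq]
  | single n m =>
    have h := LinearMap.congr_fun (hT.pow_left n).eq m
    simpa [lambdaDel, lambdaSubst_single] using h

theorem aeval_intertwine {N : Type w} [AddCommGroup N] [Module k N] (φ : N →ₗ[k] M)
    (A : Module.End k N) (B : Module.End k M) (h : ∀ x, φ (A x) = B (φ x)) (f : k[X]) (x : N) :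
    φ (aeval A f x) = aeval B f (φ x) := by
  induction f using Polynomial.induction_on' with
  | add f g hf hg => simp [hf, hg]
  | monomial n c =>
    have : ∀ x, φ ((A ^ n) x) = (B ^ n) (φ x) := by
      induction n with
      | zero => simp
      | succ n ih => intro x; simp [pow_succ, ih, h]
    simp [aeval_monomial, this]

theorem aeval_comm (A B : Module.End k M) (h : Commute A B) (f g : k[X]) (x : M) :
    aeval A f (aeval B g x) = aeval B g (aeval A f x) :=
  aeval_intertwine (aeval A f) B B (fun x =>
    (aeval_intertwine B A A (fun x => LinearMap.congr_fun h.eq.symm x) f x).symm) g x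

theorem aeval_del [Module k[X] M] [IsScalarTower k k[X] M] (f : k[X]) (x : M) :
    aeval (del k M) f x = f • x := by
  have : aeval (del k M) f = Algebra.lsmul k k M f := by
    rw [del, aeval_algHom_apply, aeval_X_left_apply]
  rw [this]; rfl

theorem commute_lambdaDel_lambdaShift [Module k[X] M] [IsScalarTower k k[X] M] :
    Commute (lambdaDel k M) (lambdaShift k M) := by
  refine LinearMap.ext fun p => ?_
  induction p using Finsupp.induction_linear with
  | zero => simp
  | add p q hp hq => rw [map_add, map_add, hp, hq]
  | single n m => simp [lambdaDel, lambdaShift, Module.End.mul_apply]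

theorem aeval_shift_comm [Module k[X] M] [IsScalarTower k k[X] M] (f g : k[X]) (p : ℕ →₀ M) :
    aeval (-lambdaShift k M) f (aeval (lambdaDel k M + lambdaShift k M) g p) =
      aeval (lambdaDel k M + lambdaShift k M) g (aeval (-lambdaShift k M) f p) := by
  have h : Commute (lambdaShift k M) (lambdaDel k M + lambdaShift k M) :=
    (commute_lambdaDel_lambdaShift (k := k) (M := M)).symm.add_right (Commute.refl _)
  exact aeval_comm _ _ h.neg_left f g p

theorem commute_scalar (α : k) (T : Module.End k M) : Commute (α • (1 : Module.End k M)) T :=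
  (Commute.one_left T).smul_left α

theorem commute_neg_del [Module k[X] M] [IsScalarTower k k[X] M] (α : k) :
    Commute (-del k M - α • (1 : Module.End k M)) (del k M) :=
  (Commute.refl (del k M)).neg_left.sub_left (commute_scalar α _)

theorem neg_neg_del_sub [Module k[X] M] [IsScalarTower k k[X] M] (α : k) :
    -(-del k M - α • (1 : Module.End k M)) = del k M + α • (1 : Module.End k M) := by
  abel

theorem del_add_neg_del_sub [Module k[X] M] [IsScalarTower k k[X] M] (α : k) :
    del k M + (-del k M - α • (1 : Module.End k M)) = -(α • (1 : Module.End k M)) := by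
  abel

end Sesquilinear

namespace GDSuperalgebra

variable {k : Type u} {V : Type v} [Field k] [AddCommGroup V] [Module k V]

/-- The `λ`-brackets of generators: for homogeneous `a`, `b` in `V`,
`[a_λ b] = [a, b] + (-1) ^ (|a| |b|) ∂ (b ∘ a) + λ (a ∘ b + (-1) ^ (|a| |b|) b ∘ a)`. -/
noncomputable def genBracket (G : GDSuperalgebra k V) : V →ₗ[k] V →ₗ[k] (ℕ →₀ k[X] ⊗[k] V) :=
  G.bracket.compr₂ (Finsupp.lsingle 0 ∘ₗ TensorProduct.mk k k[X] V 1)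
    + G.oppMul.compr₂ (Finsupp.lsingle 0 ∘ₗ TensorProduct.mk k k[X] V X)
    + (G.mul + G.oppMul).compr₂ (Finsupp.lsingle 1 ∘ₗ TensorProduct.mk k k[X] V 1)

/-- `[a_λ g(∂) b] = g(∂ + λ) [a_λ b]` for `a`, `b` in `V`. -/
noncomputable def rightBracket (G : GDSuperalgebra k V) :
    V →ₗ[k] k[X] ⊗[k] V →ₗ[k] (ℕ →₀ k[X] ⊗[k] V) :=
  LinearMap.mk₂ k
    (fun a y => TensorProduct.lift ((LinearMap.lcomp k (ℕ →₀ k[X] ⊗[k] V) (G.genBracket a)) ∘ₗ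
      (aeval (lambdaDel k (k[X] ⊗[k] V) + lambdaShift k (k[X] ⊗[k] V))).toLinearMap) y)
    (fun a a' y => by
      induction y using TensorProduct.induction_on with
      | zero => simp
      | tmul g b => simp
      | add y z hy hz => simp only [map_add] at hy hz ⊢; rw [hy, hz]; abel)
    (fun c a y => by
      induction y using TensorProduct.induction_on with
      | zero => simp
      | tmul g b => simp
      | add y z hy hz => simp only [map_add] at hy hz ⊢; rw [hy, hz, smul_add])
    (fun a y z => map_add _ y z)
    (fun c a y => map_smul _ c y)

/-- The `λ`-bracket of the quadratic Lie conformal superalgebra on `H ⊗ V`: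
`[f(∂) a_λ g(∂) b] = f(-λ) g(∂ + λ) [a_λ b]` for `a`, `b` in `V`. -/
noncomputable def quadBracket (G : GDSuperalgebra k V) :
    k[X] ⊗[k] V →ₗ[k] k[X] ⊗[k] V →ₗ[k] (ℕ →₀ k[X] ⊗[k] V) :=
  TensorProduct.lift (LinearMap.mk₂ k
    (fun f a => aeval (-lambdaShift k (k[X] ⊗[k] V)) f ∘ₗ G.rightBracket a)
    (fun f f' a => by simp [LinearMap.add_comp])
    (fun c f a => by simp [LinearMap.smul_comp])
    (fun f a a' => by simp [LinearMap.comp_add])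
    (fun c f a => by simp [LinearMap.comp_smul]))

theorem quadBracket_tmul (G : GDSuperalgebra k V) (f g : k[X]) (a b : V) :
    G.quadBracket (f ⊗ₜ a) (g ⊗ₜ b) =
      aeval (-lambdaShift k (k[X] ⊗[k] V)) f
        (aeval (lambdaDel k (k[X] ⊗[k] V) + lambdaShift k (k[X] ⊗[k] V)) g
          (G.genBracket a b)) := by
  simp [quadBracket, rightBracket]

theorem lambdaSubst_quadBracket (G : GDSuperalgebra k V) (T : Module.End k (k[X] ⊗[k] V))
    (hT : Commute T (del k (k[X] ⊗[k] V))) (f g : k[X]) (a b : V) :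
    lambdaSubst T (G.quadBracket (f ⊗ₜ a) (g ⊗ₜ b)) =
      aeval (-T) f (aeval (del k (k[X] ⊗[k] V) + T) g
        (1 ⊗ₜ G.bracket a b + X ⊗ₜ G.oppMul a b
          + T (1 ⊗ₜ (G.mul a b + G.oppMul a b)))) := by
  rw [quadBracket_tmul, aeval_intertwine (lambdaSubst T) _ (-T),
    aeval_intertwine (lambdaSubst T) _ (del k (k[X] ⊗[k] V) + T)]
  · simp [genBracket, lambdaSubst_single]
  · intro x; simp [lambdaSubst_shift, lambdaSubst_del T hT]
  · intro x; simp [lambdaSubst_shift]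

theorem quadBracket_smul_left (G : GDSuperalgebra k V) (f : k[X]) (x y : k[X] ⊗[k] V) :
    G.quadBracket (f • x) y =
      aeval (-lambdaShift k (k[X] ⊗[k] V)) f (G.quadBracket x y) := by
  induction x using TensorProduct.induction_on with
  | zero => simp
  | add x z hx hz => simp [hx, hz]
  | tmul h a =>
    induction y using TensorProduct.induction_on with
    | zero => simp
    | add y z hy hz => simp [hy, hz]
    | tmul g b =>
      rw [TensorProduct.smul_tmul', quadBracket_tmul, quadBracket_tmul, smul_eq_mul, map_mul]
      rfl

theorem quadBracket_smul_right (G : GDSuperalgebra k V) (f : k[X]) (x y : k[X] ⊗[k] V) :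
    G.quadBracket x (f • y) =
      aeval (lambdaDel k (k[X] ⊗[k] V) + lambdaShift k (k[X] ⊗[k] V)) f
        (G.quadBracket x y) := by
  induction x using TensorProduct.induction_on with
  | zero => simp
  | add x z hx hz => simp [hx, hz]
  | tmul h a =>
    induction y using TensorProduct.induction_on with
    | zero => simp
    | add y z hy hz => simp [hy, hz]
    | tmul g b =>
      rw [TensorProduct.smul_tmul', quadBracket_tmul, quadBracket_tmul, smul_eq_mul, map_mul,
        Module.End.mul_apply]
      exact aeval_shift_comm _ _ _

/-- The value `[x_α y]`. -/
noncomputable def quadEval (G : GDSuperalgebra k V) (α : k) :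
    k[X] ⊗[k] V →ₗ[k] k[X] ⊗[k] V →ₗ[k] k[X] ⊗[k] V :=
  G.quadBracket.compr₂ (lambdaEval α)

theorem quadEval_apply (G : GDSuperalgebra k V) (α : k) (x y : k[X] ⊗[k] V) :
    lambdaEval α (G.quadBracket x y) = G.quadEval α x y := rfl

theorem lambdaSubst_quad_smul_left (G : GDSuperalgebra k V) (T : Module.End k (k[X] ⊗[k] V))
    (f : k[X]) (x y : k[X] ⊗[k] V) :
    lambdaSubst T (G.quadBracket (f • x) y) =
      aeval (-T) f (lambdaSubst T (G.quadBracket x y)) := by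
  rw [quadBracket_smul_left]
  exact aeval_intertwine _ _ _ (fun x => by simp [lambdaSubst_shift]) f _

theorem lambdaSubst_quad_smul_right (G : GDSuperalgebra k V) (T : Module.End k (k[X] ⊗[k] V))
    (hT : Commute T (del k (k[X] ⊗[k] V))) (f : k[X]) (x y : k[X] ⊗[k] V) :
    lambdaSubst T (G.quadBracket x (f • y)) =
      aeval (del k (k[X] ⊗[k] V) + T) f (lambdaSubst T (G.quadBracket x y)) := by
  rw [quadBracket_smul_right]
  exact aeval_intertwine _ _ _ (fun x => by simp [lambdaSubst_shift, lambdaSubst_del T hT]) f _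

theorem aeval_neg_scalar {M : Type w} [AddCommGroup M] [Module k M] (α : k) (f : k[X]) (x : M) :
    aeval (-(α • (1 : Module.End k M))) f x = f.eval (-α) • x := by
  have : -(α • (1 : Module.End k M)) = algebraMap k (Module.End k M) (-α) := by
    rw [Algebra.algebraMap_eq_smul_one, neg_smul]
  rw [this, aeval_algebraMap_apply, Module.algebraMap_end_apply]
  simp

theorem aeval_del_add {M : Type w} [AddCommGroup M] [Module k M]
    [Module k[X] M] [IsScalarTower k k[X] M] (α : k) (f : k[X]) (x : M) :
    aeval (del k M + α • (1 : Module.End k M)) f x = f.comp (X + C α) • x := by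
  rw [← aeval_del, aeval_comp]
  simp [Algebra.algebraMap_eq_smul_one]

theorem quadEval_smul_left (G : GDSuperalgebra k V) (α : k) (f : k[X]) (x y : k[X] ⊗[k] V) :
    G.quadEval α (f • x) y = f.eval (-α) • G.quadEval α x y := by
  exact (G.lambdaSubst_quad_smul_left _ f x y).trans (aeval_neg_scalar _ _ _)

theorem quadEval_smul_right (G : GDSuperalgebra k V) (α : k) (f : k[X]) (x y : k[X] ⊗[k] V) :
    G.quadEval α x (f • y) = f.comp (X + C α) • G.quadEval α x y := by
  exact (G.lambdaSubst_quad_smul_right _ (commute_scalar _ _) f x y).trans (aeval_del_add _ _ _)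

theorem quadEval_gen (G : GDSuperalgebra k V) (α : k) (a b : V) :
    G.quadEval α ((1 : k[X]) ⊗ₜ a) ((1 : k[X]) ⊗ₜ b) =
      (1 : k[X]) ⊗ₜ G.bracket a b + (X : k[X]) ⊗ₜ G.oppMul a b
        + α • ((1 : k[X]) ⊗ₜ (G.mul a b + G.oppMul a b)) := by
  refine (G.lambdaSubst_quadBracket _ (commute_scalar α (del k (k[X] ⊗[k] V))) 1 1 a b).trans ?_
  simp

/-- The `λ`-bracket of homogeneous generators in the quadratic Lie conformal superalgebra. -/
theorem quadEval_gen_of_mem (G : GDSuperalgebra k V) (α : k) {i j : ZMod 2} {a b : V}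
    (ha : a ∈ G.grading i) (hb : b ∈ G.grading j) :
    G.quadEval α ((1 : k[X]) ⊗ₜ a) ((1 : k[X]) ⊗ₜ b) =
      (1 : k[X]) ⊗ₜ G.bracket a b + superSign i j • ((X : k[X]) ⊗ₜ G.mul b a)
        + α • ((1 : k[X]) ⊗ₜ (G.mul a b + superSign i j • G.mul b a)) := by
  rw [quadEval_gen, G.oppMul_of_mem ha hb]
  simp only [TensorProduct.tmul_smul]

theorem oppMul_mem (G : GDSuperalgebra k V) {i j : ZMod 2} {a b : V}
    (ha : a ∈ G.grading i) (hb : b ∈ G.grading j) : G.oppMul a b ∈ G.grading (i + j) := by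
  rw [G.oppMul_of_mem ha hb]
  exact zsmul_mem (add_comm j i ▸ G.mul_mem hb ha) _

theorem baseChange_induction {W : Submodule k V} {P : k[X] ⊗[k] V → Prop}
    (gen : ∀ a ∈ W, P ((1 : k[X]) ⊗ₜ a)) (zero : P 0) (add : ∀ x y, P x → P y → P (x + y))
    (smul : ∀ (f : k[X]) x, P x → P (f • x)) {x : k[X] ⊗[k] V} (hx : x ∈ W.baseChange k[X]) :
    P x := by
  obtain ⟨y, rfl⟩ := hx
  induction y using TensorProduct.induction_on with
  | zero => simpa using zero
  | add y z hy hz => rw [map_add]; exact add _ _ hy hz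
  | tmul f a =>
    have := smul f _ (gen a a.2)
    simpa [TensorProduct.smul_tmul'] using this

theorem quadBracket_mem (G : GDSuperalgebra k V) {i j : ZMod 2} {x y : k[X] ⊗[k] V}
    (hx : x ∈ (G.grading i).baseChange k[X]) (hy : y ∈ (G.grading j).baseChange k[X]) (n : ℕ) :
    G.quadBracket x y n ∈ (G.grading (i + j)).baseChange k[X] := by
  let W := (G.grading (i + j)).baseChange k[X]
  let P : Submodule k (ℕ →₀ k[X] ⊗[k] V) :=
    { carrier := {p | ∀ n, p n ∈ W}
      add_mem' := fun hp hq n => W.add_mem (hp n) (hq n)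
      zero_mem' := fun n => W.zero_mem
      smul_mem' := fun c p hp n => by
        simpa using (W.restrictScalars k).smul_mem c (hp n) }
  have hS : ∀ p ∈ P, lambdaShift k (k[X] ⊗[k] V) p ∈ P := by
    intro p hp n
    cases n with
    | zero =>
      have : lambdaShift k (k[X] ⊗[k] V) p 0 = 0 :=
        Finsupp.mapDomain_of_notMem_range p 0 (by simp)
      rw [this]; exact W.zero_mem
    | succ n =>
      have : lambdaShift k (k[X] ⊗[k] V) p (n + 1) = p n :=
        Finsupp.mapDomain_apply Nat.succ_injective p n
      rw [this]; exact hp n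
  have hD : ∀ p ∈ P, lambdaDel k (k[X] ⊗[k] V) p ∈ P := by
    intro p hp n
    exact W.smul_mem X (hp n)
  have hA : ∀ (T : Module.End k (ℕ →₀ k[X] ⊗[k] V)), (∀ p ∈ P, T p ∈ P) →
      ∀ (f : k[X]), ∀ p ∈ P, aeval T f p ∈ P := by
    intro T hT f
    induction f using Polynomial.induction_on' with
    | add f g hf hg => intro p hp; rw [map_add]; exact P.add_mem (hf p hp) (hg p hp)
    | monomial m c =>
      have : ∀ p ∈ P, (T ^ m) p ∈ P := by
        induction m with
        | zero => simp
        | succ m ih => intro p hp; rw [pow_succ']; exact hT _ (ih p hp)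
      intro p hp
      simpa [aeval_monomial] using P.smul_mem c (this p hp)
  suffices h : G.quadBracket x y ∈ P from h n
  refine baseChange_induction (P := fun x => G.quadBracket x y ∈ P) (fun a ha => ?_) (by simp)
    (fun x z hx hz => ?_) (fun f x hx => ?_) hx
  · refine baseChange_induction (P := fun y => G.quadBracket ((1 : k[X]) ⊗ₜ a) y ∈ P)
      (fun b hb => ?_) (by simp) (fun x z hx hz => ?_) (fun f x hx => ?_) hy
    · have hW : ∀ (f : k[X]) (v : V), v ∈ G.grading (i + j) → f ⊗ₜ[k] v ∈ W :=
        fun f v hv => Submodule.tmul_mem_baseChange_of_mem f hv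
      have hs : ∀ (m : ℕ) (w : k[X] ⊗[k] V), w ∈ W → Finsupp.single m w ∈ P := by
        intro m w hw n
        rw [Finsupp.single_apply]
        split_ifs
        · exact hw
        · exact W.zero_mem
      have key : G.genBracket a b ∈ P := by
        simp only [genBracket, LinearMap.add_apply, LinearMap.compr₂_apply,
          LinearMap.comp_apply, Finsupp.lsingle_apply, TensorProduct.mk_apply]
        exact P.add_mem (P.add_mem (hs _ _ (hW _ _ (G.bracket_mem ha hb)))
          (hs _ _ (hW _ _ (G.oppMul_mem ha hb))))
          (hs _ _ (hW _ _ (add_mem (G.mul_mem ha hb) (G.oppMul_mem ha hb))))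
      simpa [quadBracket_tmul] using key
    · rw [map_add]; exact P.add_mem hx hz
    · rw [quadBracket_smul_right]
      exact hA _ (fun p hp => P.add_mem (hD p hp) (hS p hp)) f _ hx
  · rw [map_add]; exact P.add_mem hx hz
  · rw [quadBracket_smul_left]
    exact hA _ (fun p hp => by
      rw [LinearMap.neg_apply, ← neg_one_smul k]; exact P.smul_mem _ (hS p hp)) f _ hx

theorem quad_skew (G : GDSuperalgebra k V) {i j : ZMod 2} {x y : k[X] ⊗[k] V}
    (hx : x ∈ (G.grading i).baseChange k[X]) (hy : y ∈ (G.grading j).baseChange k[X]) (α : k)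
    (T : Module.End k (k[X] ⊗[k] V))
    (hTd : T = -del k (k[X] ⊗[k] V) - α • (1 : Module.End k (k[X] ⊗[k] V))) :
    G.quadEval α x y = -(superSign i j • lambdaSubst T (G.quadBracket y x)) := by
  have hT : Commute T (del k (k[X] ⊗[k] V)) := by
    rw [hTd]; exact commute_neg_del α
  have hT1 : -T = del k (k[X] ⊗[k] V) + α • (1 : Module.End k (k[X] ⊗[k] V)) := by
    rw [hTd]; exact neg_neg_del_sub α
  have hT2 : del k (k[X] ⊗[k] V) + T = -(α • (1 : Module.End k (k[X] ⊗[k] V))) := by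
    rw [hTd]; exact del_add_neg_del_sub α
  have hd : ∀ v : V, T ((1 : k[X]) ⊗ₜ v) = -((X : k[X]) ⊗ₜ v) - α • ((1 : k[X]) ⊗ₜ v) := by
    intro v
    simp [hTd, del, TensorProduct.smul_tmul']
  clear hTd
  refine baseChange_induction
    (P := fun x => G.quadEval α x y = -(superSign i j • lambdaSubst T (G.quadBracket y x)))
    (fun a ha => ?_) (by simp) (fun x z hx hz => ?_) (fun f x hx => ?_) hx
  · refine baseChange_induction
      (P := fun y => G.quadEval α ((1 : k[X]) ⊗ₜ a) y =
        -(superSign i j • lambdaSubst T (G.quadBracket y ((1 : k[X]) ⊗ₜ a))))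
      (fun b hb => ?_) (by simp) (fun x z hx hz => ?_) (fun f x hx => ?_) hy
    · rw [quadEval_gen, lambdaSubst_quadBracket _ _ hT, G.oppMul_of_mem ha hb,
        G.oppMul_of_mem hb ha, G.bracket_skew ha hb, superSign_comm j i]
      simp only [map_one, Module.End.one_apply, map_add, map_zsmul, hd, TensorProduct.tmul_add, TensorProduct.tmul_neg,
        TensorProduct.tmul_smul]
      rcases superSign_eq i j with h | h <;> rw [h] <;> module
    · rw [map_add, map_add, LinearMap.add_apply, map_add, hx, hz, smul_add, neg_add]
    · rw [quadEval_smul_right, hx, lambdaSubst_quad_smul_left, hT1, aeval_del_add, smul_neg,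
        smul_comm]
  · rw [map_add, map_add, LinearMap.add_apply, map_add, hx, hz, smul_add, neg_add]
  · rw [quadEval_smul_left, hx, lambdaSubst_quad_smul_right _ _ hT, hT2, aeval_neg_scalar, smul_neg,
      smul_comm]

theorem mul_mem_swap (G : GDSuperalgebra k V) {i j : ZMod 2} {a b : V}
    (ha : a ∈ G.grading i) (hb : b ∈ G.grading j) : G.mul b a ∈ G.grading (i + j) := by
  rw [add_comm]; exact G.mul_mem hb ha

theorem quad_jacobi_aux (G : GDSuperalgebra k V) {i j l : ZMod 2} {a b c : V}
    (ha : a ∈ G.grading i) (hb : b ∈ G.grading j) (hc : c ∈ G.grading l) :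
    let o := G.oppMul
    let s := G.mul + G.oppMul
    let h := G.bracket
    let e := superSign i j
    (h a (h b c) - e • h b (h a c) - h (h a b) c = 0) ∧
    (o a (h b c) + h a (o b c) - e • (o b (h a c) + h b (o a c)) - o (h a b) c = 0) ∧
    (s a (h b c) + h a (o b c) - e • h b (s a c) - s (h a b) c + h (o a b) c
      - h (s a b) c = 0) ∧
    (h a (s b c) - e • (s b (h a c) + h b (o a c)) - s (h a b) c + h (o a b) c = 0) ∧
    (o a (o b c) - e • o b (o a c) = 0) ∧
    (s a (o b c) + o a (o b c) - e • o b (s a c) + o (o a b) c - o (s a b) c = 0) ∧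
    (o a (s b c) - e • (s b (o a c) + o b (o a c)) + o (o a b) c = 0) ∧
    (s a (o b c) + s (o a b) c - s (s a b) c = 0) ∧
    (s (o a b) c - e • s b (o a c) = 0) ∧
    (s a (s b c) - e • s b (s a c) + s (o a b) c + s (o a b) c - s (s a b) c = 0) := by
  have s1 := superSign_eq i j
  have s2 := superSign_eq i l
  have s3 := superSign_eq j l
  intro o s h e
  simp only [o, s, h, e, LinearMap.add_apply, map_add, map_zsmul, LinearMap.smul_apply,
    G.oppMul_of_mem ha hb, G.oppMul_of_mem ha hc, G.oppMul_of_mem hb hc,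
    G.oppMul_of_mem ha (G.mul_mem hb hc), G.oppMul_of_mem ha (G.mul_mem_swap hb hc),
    G.oppMul_of_mem hb (G.mul_mem ha hc), G.oppMul_of_mem hb (G.mul_mem_swap ha hc),
    G.oppMul_of_mem (G.mul_mem ha hb) hc, G.oppMul_of_mem (G.mul_mem_swap ha hb) hc,
    G.oppMul_of_mem ha (G.bracket_mem hb hc), G.oppMul_of_mem hb (G.bracket_mem ha hc),
    G.oppMul_of_mem (G.bracket_mem ha hb) hc, G.bracket_skew (G.mul_mem ha hb) hc,
    G.bracket_skew (G.mul_mem_swap ha hb) hc]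
  have L1 := G.left_symm ha hb hc
  have L2 := G.left_symm ha hc hb
  have L3 := G.left_symm hb hc ha
  have R1 := G.right_comm ha hb hc
  have R2 := G.right_comm hb ha hc
  have R3 := G.right_comm hc ha hb
  have J := G.bracket_jacobi ha hb hc
  have C1 := G.compat ha hb hc
  have C2 := G.compat ha hc hb
  have C3 := G.compat hb ha hc
  have C4 := G.compat hb hc ha
  have C5 := G.compat hc ha hb
  have C6 := G.compat hc hb ha
  simp only [G.bracket_skew hb ha, G.bracket_skew hc ha, G.bracket_skew hc hb, map_neg, map_zsmul,
    LinearMap.neg_apply, LinearMap.smul_apply, superSign_add_left, superSign_add_right,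
    superSign_comm j i, superSign_comm l i, superSign_comm l j] at *
  generalize superSign i j = p at *
  generalize superSign i l = q at *
  generalize superSign j l = r at *
  rcases s1 with rfl | rfl <;> rcases s2 with rfl | rfl <;> rcases s3 with rfl | rfl <;>
    simp only [one_smul, neg_smul, mul_one, mul_neg, neg_neg] at * <;>
    refine ⟨?_, ?_, ?_, ?_, ?_, ?_, ?_, ?_, ?_, ?_⟩ <;> grind

theorem quad_jacobi_gen (G : GDSuperalgebra k V) {i j l : ZMod 2} {a b c : V}
    (ha : a ∈ G.grading i) (hb : b ∈ G.grading j) (hc : c ∈ G.grading l) (α β : k) :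
    G.quadEval α ((1 : k[X]) ⊗ₜ a) (G.quadEval β ((1 : k[X]) ⊗ₜ b) ((1 : k[X]) ⊗ₜ c))
      - superSign i j •
        G.quadEval β ((1 : k[X]) ⊗ₜ b) (G.quadEval α ((1 : k[X]) ⊗ₜ a) ((1 : k[X]) ⊗ₜ c)) =
      G.quadEval (α + β) (G.quadEval α ((1 : k[X]) ⊗ₜ a) ((1 : k[X]) ⊗ₜ b))
        ((1 : k[X]) ⊗ₜ c) := by
  have hX : ∀ v : V, (X : k[X]) ⊗ₜ[k] v = (X : k[X]) • ((1 : k[X]) ⊗ₜ[k] v) := by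
    intro v; simp [TensorProduct.smul_tmul']
  have hL : ∀ (α : k) (x y : k[X] ⊗[k] V),
      G.quadEval α ((X : k[X]) • x) y = -(α • G.quadEval α x y) := by
    intro α x y; rw [quadEval_smul_left, eval_X]; module
  have hR : ∀ (α : k) (x y : k[X] ⊗[k] V),
      G.quadEval α x ((X : k[X]) • y) =
        (X : k[X]) • G.quadEval α x y + α • G.quadEval α x y := by
    intro α x y; rw [quadEval_smul_right, X_comp, add_smul, ← algebraMap_eq, algebraMap_smul]
  have H := G.quad_jacobi_aux ha hb hc
  obtain ⟨h1, h2, h3, h4, h5, h6, h7, h8, h9, h10⟩ := H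
  have t : ∀ {v w : V}, v = w → (1 : k[X]) ⊗ₜ[k] v = (1 : k[X]) ⊗ₜ[k] w := fun h => by rw [h]
  replace h1 := t h1
  replace h2 := t h2
  replace h3 := t h3
  replace h4 := t h4
  replace h5 := t h5
  replace h6 := t h6
  replace h7 := t h7
  replace h8 := t h8
  replace h9 := t h9
  replace h10 := t h10
  simp only [TensorProduct.tmul_add, TensorProduct.tmul_sub, TensorProduct.tmul_smul,
    TensorProduct.tmul_zero, map_add, LinearMap.add_apply]
    at h1 h2 h3 h4 h5 h6 h7 h8 h9 h10
  simp only [quadEval_gen, hX, map_add, LinearMap.add_apply, map_smul, LinearMap.smul_apply, hL, hR,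
    TensorProduct.tmul_add]
  simp only [← algebraMap_smul k[X] α, ← algebraMap_smul k[X] β,
    ← algebraMap_smul k[X] (α + β), map_add]
  generalize algebraMap k k[X] α = A
  generalize algebraMap k k[X] β = B
  generalize (X : k[X]) = D
  linear_combination (norm := module) h1 + D • h2 + A • h3 + B • h4 + (D * D) • h5
    + (D * A) • h6 + (D * B) • h7 + (A * A) • h8 + (B * B) • h9 + (A * B) • h10

theorem quad_jacobi (G : GDSuperalgebra k V) {i j : ZMod 2} {x y : k[X] ⊗[k] V}
    (hx : x ∈ (G.grading i).baseChange k[X]) (hy : y ∈ (G.grading j).baseChange k[X])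
    (z : k[X] ⊗[k] V) (α β : k) :
    G.quadEval α x (G.quadEval β y z) - superSign i j • G.quadEval β y (G.quadEval α x z) =
      G.quadEval (α + β) (G.quadEval α x y) z := by
  have hz : z ∈ ⨆ l, (G.grading l).baseChange k[X] := by
    rw [(G.isInternal.baseChange (S := k[X])).submodule_iSup_eq_top]; trivial
  induction hz using Submodule.iSup_induction' with
  | zero => simp
  | add z w _ _ hz hw => simp only [map_add, ← hz, ← hw, smul_add]; abel
  | mem l z hz =>
  refine baseChange_induction (P := fun z => G.quadEval α x (G.quadEval β y z)
      - superSign i j • G.quadEval β y (G.quadEval α x z) =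
      G.quadEval (α + β) (G.quadEval α x y) z)
    (fun c hc => ?_) (by simp) (fun z w hz hw => ?_) (fun f z hz => ?_) hz
  · refine baseChange_induction (P := fun x => G.quadEval α x (G.quadEval β y (1 ⊗ₜ c))
      - superSign i j • G.quadEval β y (G.quadEval α x (1 ⊗ₜ c)) =
      G.quadEval (α + β) (G.quadEval α x y) (1 ⊗ₜ c))
      (fun a ha => ?_) (by simp) (fun z w hz hw => ?_) (fun f z hz => ?_) hx
    · refine baseChange_induction
        (P := fun y => G.quadEval α (1 ⊗ₜ a) (G.quadEval β y (1 ⊗ₜ c))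
        - superSign i j • G.quadEval β y (G.quadEval α (1 ⊗ₜ a) (1 ⊗ₜ c)) =
        G.quadEval (α + β) (G.quadEval α (1 ⊗ₜ a) y) (1 ⊗ₜ c))
        (fun b hb => G.quad_jacobi_gen ha hb hc α β) (by simp)
        (fun z w hz hw => ?_) (fun f z hz => ?_) hy
      · simp only [map_add, LinearMap.add_apply, ← hz, ← hw, smul_add]; abel
      · simp only [quadEval_smul_left, quadEval_smul_right, map_smul, ← hz, smul_sub]
        rw [smul_comm (superSign i j)]
        simp
    · simp only [map_add, LinearMap.add_apply, ← hz, ← hw, smul_add]; abel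
    · simp only [quadEval_smul_left, map_smul, LinearMap.smul_apply, ← hz, smul_sub]
      rw [smul_comm (superSign i j)]
  · simp only [map_add, ← hz, ← hw, smul_add]; abel
  · simp only [quadEval_smul_right, ← hz, smul_sub, comp_assoc]
    rw [smul_comm (superSign i j)]
    simp only [add_comp, X_comp, C_comp, add_assoc, C_add]
    rw [add_comm (C β) (C α)]

/-- The quadratic Lie conformal superalgebra `L(V) = H ⊗ V` of a Gelfand--Dorfman superalgebra
`V`. -/
noncomputable def quadraticLie (G : GDSuperalgebra k V) :
    LieConformalSuperalgebra k (k[X] ⊗[k] V) where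
  grading i := (G.grading i).baseChange k[X]
  isInternal := G.isInternal.baseChange
  bracket := G.quadBracket
  bracket_mem := G.quadBracket_mem
  bracket_del_left x y α := by
    have := G.quadEval_smul_left α X x y
    rw [eval_X] at this
    exact this.trans (by rw [quadEval_apply]; module)
  bracket_del_right x y α := by
    have := G.quadEval_smul_right α X x y
    rw [X_comp, add_smul, ← algebraMap_eq, algebraMap_smul] at this
    exact this
  skew hx hy α := G.quad_skew hx hy α _ rfl
  jacobi hx hy z α β := G.quad_jacobi hx hy z α β

end GDSuperalgebra

/-! The adjoint representation of `L(V)` need not be faithful: if the product is zero, so is the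
`λ`-bracket. The remedy is to embed `V` in a larger finite-dimensional Novikov superalgebra `E` and
to restrict the adjoint representation of `L(E)` to `L(V)`.

Write `L_a` for left multiplication and `R_a` (`oppMul a`) for right multiplication with its sign.
Let `C ⊆ End V` be the supercentralizer of all `R_b`; it contains `1` and, by right commutativity,
every `R_a`. Put `E = V ⊕ M` with `M = V ⊕ C` and `M ∘ M = 0`. On the copy of `V` in `M` the two
actions of `V` are the product, and for `s ∈ C` `a ∘ s = ((-1)^{|a||s|} s(a), [L_a, s])`, `s ∘ b =
(0, s R_b)`. The identity `[L_a, R_b] = R_{a∘b} - R_a R_b` (`mulLeft_mul_oppMul`) makes `C` stable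
under `[L_a, ·]` (`lieOp_mem_centralizer`), so the product is well defined; `extMul_right_comm` and
`extMul_left_symm` show that `E` is Novikov.

The element `1 ∈ C` is even, `a ∘ 1 = a` lies in the copy of `V`, and `1 ∘ a = R_a` lies in `C`.
Hence the component of `[f(∂)a_λ 1]` in the copy of `V` is `(1 + λ) f(-λ) a`. If it vanishes for all
values of `λ`, then evaluating at infinitely many points gives zero
(`eq_zero_of_quadBracket_eq_zero`), which is faithfulness. -/

theorem superSign_mul_self (i j : ZMod 2) : superSign i j * superSign i j = 1 := by
  rcases superSign_eq i j with h | h <;> simp [h]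

/-! ### Gradings given by the eigenspaces of an involution. -/

section Involution

variable {k : Type u} {X : Type v} [Field k] [AddCommGroup X] [Module k X]

/-- The eigenspaces of an endomorphism for the eigenvalues `1` and `-1`. -/
def signEigenspace (T : Module.End k X) (i : ZMod 2) : Submodule k X :=
  LinearMap.ker (T - superSign i 1 • (1 : Module.End k X))

theorem mem_signEigenspace {T : Module.End k X} {i : ZMod 2} {x : X} :
    x ∈ signEigenspace T i ↔ T x = superSign i 1 • x := by
  simp [signEigenspace, sub_eq_zero]

/-- Since `2` is invertible, `x = (x + Tx)/2 + (x - Tx)/2` splits every vector, and a vector with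
`Tx = x = -x` is zero. -/
theorem isInternal_signEigenspace [CharZero k] {T : Module.End k X} (hT : ∀ x, T (T x) = x) :
    DirectSum.IsInternal (signEigenspace T) := by
  have h0 : ∀ {x}, x ∈ signEigenspace T 0 ↔ T x = x := by
    intro x; simp [mem_signEigenspace, superSign]
  have h1 : ∀ {x}, x ∈ signEigenspace T 1 ↔ T x = -x := by
    intro x; simp [mem_signEigenspace, superSign, ZMod.val_one]
  have h2 : (2 : k) ≠ 0 := two_ne_zero
  rw [DirectSum.isInternal_submodule_iff_isCompl (i := 0) (j := 1) _ (by decide)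
    (Set.ext fun i => by revert i; decide)]
  refine ⟨?_, ?_⟩
  · rw [Submodule.disjoint_def]
    intro x hx hx'
    rw [h0] at hx
    rw [h1, hx] at hx'
    have : (2 : k) • x = 0 := by rw [two_smul]; nth_rewrite 1 [hx']; simp
    exact (smul_eq_zero.1 this).resolve_left h2
  · rw [codisjoint_iff, eq_top_iff]
    intro x _
    refine Submodule.mem_sup.2 ⟨(2 : k)⁻¹ • (x + T x), ?_, (2 : k)⁻¹ • (x - T x), ?_, ?_⟩
    · rw [h0]; simp [hT, add_comm]
    · rw [h1]; simp [hT, ← smul_neg]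
    · rw [← smul_add, add_add_sub_cancel, ← two_smul k x, smul_smul, inv_mul_cancel₀ h2, one_smul]

end Involution

/-! ### Parity operators and conjugation by them; identities between multiplication operators. -/

namespace NovikovSuperalgebra

variable {k : Type u} {V : Type v} [Field k] [AddCommGroup V] [Module k V]

theorem hom_ext_of_mem (N : NovikovSuperalgebra k V) {X : Type w} [AddCommGroup X] [Module k X]
    {f g : V →ₗ[k] X} (h : ∀ i, ∀ a ∈ N.grading i, f a = g a) : f = g := by
  refine LinearMap.ext fun a => ?_
  have ha : a ∈ ⨆ i, N.grading i := by
    rw [N.isInternal.submodule_iSup_eq_top]; trivial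
  induction ha using Submodule.iSup_induction' with
  | mem i a ha => exact h i a ha
  | zero => simp
  | add a b _ _ ha hb => rw [map_add, map_add, ha, hb]

/-- The operator which multiplies homogeneous elements of parity `i` by the sign of `i` and `j`. -/
noncomputable def parity (N : NovikovSuperalgebra k V) (j : ZMod 2) : Module.End k V :=
  ∑ i, superSign i j • N.proj i

theorem parity_of_mem (N : NovikovSuperalgebra k V) {i : ZMod 2} {a : V} (ha : a ∈ N.grading i)
    (j : ZMod 2) : N.parity j a = superSign i j • a := by
  simp only [parity, LinearMap.sum_apply, LinearMap.smul_apply, N.proj_of_mem ha]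
  rw [Finset.sum_eq_single i]
  · simp
  · intro b _ hb; simp [hb.symm]
  · simp

theorem parity_mul_self (N : NovikovSuperalgebra k V) (j : ZMod 2) :
    N.parity j * N.parity j = 1 := by
  refine N.hom_ext_of_mem fun i a ha => ?_
  rw [Module.End.mul_apply, N.parity_of_mem ha, map_zsmul, N.parity_of_mem ha, smul_smul,
    superSign_mul_self, one_smul, Module.End.one_apply]

theorem parity_parity (N : NovikovSuperalgebra k V) (j : ZMod 2) (a : V) :
    N.parity j (N.parity j a) = a :=
  LinearMap.congr_fun (N.parity_mul_self j) a

theorem sum_proj (N : NovikovSuperalgebra k V) (a : V) : ∑ i, N.proj i a = a := by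
  have : ∑ i, N.proj i = LinearMap.id := by
    refine N.hom_ext_of_mem fun i a ha => ?_
    simp only [LinearMap.sum_apply, N.proj_of_mem ha]
    simp
  simpa using LinearMap.congr_fun this a

theorem proj_mem (N : NovikovSuperalgebra k V) (i : ZMod 2) (a : V) :
    N.proj i a ∈ N.grading i := by
  simp [proj]

/-- The grading is recovered from the single involution `N.parity 1`, which lets the grading of the
extension be defined by eigenspaces. -/
theorem mem_grading_iff [CharZero k] (N : NovikovSuperalgebra k V) {i : ZMod 2} {a : V} :
    a ∈ N.grading i ↔ N.parity 1 a = superSign i 1 • a := by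
  refine ⟨fun ha => N.parity_of_mem ha 1, fun ha => ?_⟩
  have hs : ∀ l, l ≠ i → N.proj l a = 0 := by
    intro l hl
    have h := congrArg (N.proj l) ha
    have hp : N.proj l (N.parity 1 a) = superSign l 1 • N.proj l a := by
      have : N.proj l ∘ₗ N.parity 1 = superSign l 1 • N.proj l := by
        refine N.hom_ext_of_mem fun j b hb => ?_
        simp only [LinearMap.comp_apply, LinearMap.smul_apply, N.parity_of_mem hb, map_zsmul,
          N.proj_of_mem hb]
        split_ifs with hjl
        · rw [hjl]
        · simp
      exact LinearMap.congr_fun this a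
    rw [hp, map_zsmul] at h
    -- The component of parity `l ≠ i` is multiplied by both signs at once, so its double vanishes.
    have h2 : (2 : k) • N.proj l a = 0 := by
      have hsign : ∀ l i : ZMod 2, l ≠ i → superSign l 1 = - superSign i 1 := by decide
      rw [hsign l i hl] at h
      rcases superSign_eq i 1 with e | e <;> rw [e] at h
      · linear_combination (norm := module) -h
      · linear_combination (norm := module) h
    exact (smul_eq_zero.1 h2).resolve_left two_ne_zero
  have := N.sum_proj a
  rw [Finset.sum_eq_single i (fun l _ hl => hs l hl) (by simp)] at this
  rw [← this]
  exact N.proj_mem i a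

/-- Conjugation by `N.parity j`: multiplication of homogeneous operators of parity `i` by the
sign of `i` and `j`. -/
noncomputable def twist (N : NovikovSuperalgebra k V) (j : ZMod 2) :
    Module.End k V →ₗ[k] Module.End k V :=
  LinearMap.mulLeft k (N.parity j) ∘ₗ LinearMap.mulRight k (N.parity j)

theorem twist_apply (N : NovikovSuperalgebra k V) (j : ZMod 2) (f : Module.End k V) :
    N.twist j f = N.parity j * (f * N.parity j) := rfl

theorem twist_mul (N : NovikovSuperalgebra k V) (j : ZMod 2) (f g : Module.End k V) :
    N.twist j (f * g) = N.twist j f * N.twist j g := by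
  have h := N.parity_mul_self j
  simp only [twist_apply]
  calc N.parity j * (f * g * N.parity j)
      = N.parity j * f * 1 * (g * N.parity j) := by noncomm_ring
    _ = _ := by rw [← h]; noncomm_ring

theorem twist_twist_self (N : NovikovSuperalgebra k V) (j : ZMod 2) (f : Module.End k V) :
    N.twist j (N.twist j f) = f := by
  have h := N.parity_mul_self j
  simp only [twist_apply]
  calc N.parity j * (N.parity j * (f * N.parity j) * N.parity j)
      = (N.parity j * N.parity j) * f * (N.parity j * N.parity j) := by noncomm_ring
    _ = f := by rw [h]; simp

theorem parity_mul_parity (N : NovikovSuperalgebra k V) (i j : ZMod 2) :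
    N.parity i * N.parity j = N.parity (i + j) := by
  refine N.hom_ext_of_mem fun l a ha => ?_
  rw [Module.End.mul_apply, N.parity_of_mem ha, map_zsmul, N.parity_of_mem ha, smul_smul,
    N.parity_of_mem ha, superSign_add_right, mul_comm]

theorem twist_twist (N : NovikovSuperalgebra k V) (i j : ZMod 2) (f : Module.End k V) :
    N.twist i (N.twist j f) = N.twist (i + j) f := by
  have : N.parity (i + j) = N.parity j * N.parity i := by
    rw [N.parity_mul_parity, add_comm]
  simp only [twist_apply]
  -- The factor on the right of `f` has to be split in the opposite order to the one on the left.
  nth_rewrite 2 [this]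
  rw [← N.parity_mul_parity i j]
  noncomm_ring

theorem twist_one (N : NovikovSuperalgebra k V) (j : ZMod 2) : N.twist j 1 = 1 := by
  rw [twist_apply, one_mul, parity_mul_self]

/-- The sign of the argument enters before and after applying `f` and cancels, leaving only the sign
of `f`. -/
theorem twist_eq_smul (N : NovikovSuperalgebra k V) {i : ZMod 2} {f : Module.End k V}
    (hf : ∀ l, ∀ a ∈ N.grading l, f a ∈ N.grading (i + l)) (j : ZMod 2) :
    N.twist j f = superSign i j • f := by
  refine N.hom_ext_of_mem fun l a ha => ?_
  rw [twist_apply, Module.End.mul_apply, Module.End.mul_apply, N.parity_of_mem ha, map_zsmul,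
    map_zsmul, N.parity_of_mem (hf l a ha), smul_smul, superSign_add_left, LinearMap.smul_apply]
  rw [show superSign l j * (superSign i j * superSign l j)
    = superSign i j * (superSign l j * superSign l j) by ring, superSign_mul_self, mul_one]

theorem oppMul_mem (N : NovikovSuperalgebra k V) {i j : ZMod 2} {a b : V}
    (ha : a ∈ N.grading i) (hb : b ∈ N.grading j) : N.oppMul a b ∈ N.grading (i + j) := by
  rw [N.oppMul_of_mem ha hb]
  exact zsmul_mem (add_comm j i ▸ N.mul_mem hb ha) _

theorem twist_mulLeft (N : NovikovSuperalgebra k V) {i : ZMod 2} {a : V} (ha : a ∈ N.grading i)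
    (j : ZMod 2) : N.twist j (N.mul a) = superSign i j • N.mul a :=
  N.twist_eq_smul (fun _ _ hb => N.mul_mem ha hb) j

theorem twist_oppMul (N : NovikovSuperalgebra k V) {i : ZMod 2} {a : V} (ha : a ∈ N.grading i)
    (j : ZMod 2) : N.twist j (N.oppMul a) = superSign i j • N.oppMul a :=
  N.twist_eq_smul (fun _ _ hb => N.oppMul_mem ha hb) j

/-! ### Multiplication operators -/

/-- Right commutativity read as an identity of operators in the last argument. -/
theorem mulLeft_mul (N : NovikovSuperalgebra k V) {i j : ZMod 2} {a b : V}
    (ha : a ∈ N.grading i) (hb : b ∈ N.grading j) :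
    N.mul (N.mul a b) = superSign i j • (N.oppMul b * N.mul a : Module.End k V) := by
  refine N.hom_ext_of_mem fun l c hc => ?_
  rw [LinearMap.smul_apply, Module.End.mul_apply, N.oppMul_of_mem hb (N.mul_mem ha hc),
    N.right_comm ha hb hc, smul_smul, superSign_add_right, superSign_comm j i, ← mul_assoc,
    superSign_mul_self, one_mul]

/-- Right commutativity read as an identity of operators in the first argument. -/
theorem oppMul_mul_oppMul (N : NovikovSuperalgebra k V) {i j : ZMod 2} {a b : V}
    (ha : a ∈ N.grading i) (hb : b ∈ N.grading j) :
    (N.oppMul a * N.oppMul b : Module.End k V) =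
      superSign i j • (N.oppMul b * N.oppMul a : Module.End k V) := by
  refine N.hom_ext_of_mem fun l c hc => ?_
  have h := N.right_comm hc ha hb
  simp only [LinearMap.smul_apply, Module.End.mul_apply, N.oppMul_of_mem hb hc,
    N.oppMul_of_mem ha hc, map_zsmul, N.oppMul_of_mem ha (N.mul_mem hc hb),
    N.oppMul_of_mem hb (N.mul_mem hc ha), superSign_add_right, superSign_comm j i, h]
  rcases superSign_eq i j with hp | hp <;> rcases superSign_eq i l with hq | hq <;>
    rcases superSign_eq j l with hr | hr <;> simp only [hp, hq, hr] <;> module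

/-- Left symmetry read in the middle argument `c`; right commutativity then turns `(c ∘ a) ∘ b` into
`R_a R_b c` up to sign. The right-hand side consists of right multiplications only, and this is what
later keeps the supercentralizer stable under `[L_a, ·]`. -/
theorem mulLeft_mul_oppMul (N : NovikovSuperalgebra k V) {i j : ZMod 2} {a b : V}
    (ha : a ∈ N.grading i) (hb : b ∈ N.grading j) :
    (N.mul a * N.oppMul b : Module.End k V)
        - superSign i j • (N.oppMul b * N.mul a : Module.End k V) =
      N.oppMul (N.mul a b) - (N.oppMul a * N.oppMul b : Module.End k V) := by
  refine N.hom_ext_of_mem fun l c hc => ?_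
  have h := N.left_symm ha hc hb
  have h' := N.right_comm hc ha hb
  simp only [LinearMap.smul_apply, Module.End.mul_apply, N.oppMul_of_mem hb hc,
    LinearMap.sub_apply, N.oppMul_of_mem hb (N.mul_mem ha hc),
    N.oppMul_of_mem (N.mul_mem ha hb) hc, map_zsmul, N.oppMul_of_mem ha (N.mul_mem hc hb),
    superSign_add_right, superSign_add_left, superSign_comm j i] at h h' ⊢
  rcases superSign_eq i j with hp | hp <;> rcases superSign_eq i l with hq | hq <;>
    rcases superSign_eq j l with hr | hr <;> simp only [hp, hq, hr] at h h' ⊢ <;>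
    -- The eight parity cases differ only in the signs with which the two identities enter.
    first
    | linear_combination (norm := module) h + h'
    | linear_combination (norm := module) h - h'
    | linear_combination (norm := module) -h + h'
    | linear_combination (norm := module) -h - h'

/-- Left symmetry in the last argument: left multiplications represent the supercommutator. -/
theorem mulLeft_mul_mulLeft (N : NovikovSuperalgebra k V) {i j : ZMod 2} {a b : V}
    (ha : a ∈ N.grading i) (hb : b ∈ N.grading j) :
    (N.mul a * N.mul b : Module.End k V) - superSign i j • (N.mul b * N.mul a : Module.End k V) =
      N.mul (N.mul a b) - superSign i j • N.mul (N.mul b a) := by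
  refine N.hom_ext_of_mem fun l c hc => ?_
  have h := N.left_symm ha hb hc
  simp only [LinearMap.smul_apply, Module.End.mul_apply, LinearMap.sub_apply]
  linear_combination (norm := module) -h

end NovikovSuperalgebra

namespace NovikovSuperalgebra

variable {k : Type u} {V : Type v} [Field k] [AddCommGroup V] [Module k V]

/-! ### The supercentralizer of the right multiplications -/

/-- The operators which supercommute with all right multiplications. -/
def centralizer (N : NovikovSuperalgebra k V) : Submodule k (Module.End k V) where
  carrier := {s | ∀ j, ∀ b ∈ N.grading j, (N.oppMul b * s : Module.End k V) =
    N.twist j s * N.oppMul b}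
  add_mem' hs ht j b hb := by rw [mul_add, hs j b hb, ht j b hb, map_add, add_mul]
  zero_mem' j b hb := by simp
  smul_mem' c s hs j b hb := by
    rw [mul_smul_comm, hs j b hb, map_smul, smul_mul_assoc]

theorem one_mem_centralizer (N : NovikovSuperalgebra k V) : 1 ∈ N.centralizer := by
  intro j b hb
  rw [N.twist_one, mul_one, one_mul]

theorem mul_mem_centralizer (N : NovikovSuperalgebra k V) {s t : Module.End k V}
    (hs : s ∈ N.centralizer) (ht : t ∈ N.centralizer) : s * t ∈ N.centralizer := by
  intro j b hb
  rw [← mul_assoc, hs j b hb, mul_assoc, ht j b hb, ← mul_assoc, N.twist_mul]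

theorem oppMul_mem_centralizer (N : NovikovSuperalgebra k V) (a : V) :
    (N.oppMul a : Module.End k V) ∈ N.centralizer := by
  rw [← N.sum_proj a, map_sum]
  refine Submodule.sum_mem _ fun i _ => ?_
  intro j b hb
  rw [N.twist_oppMul (N.proj_mem i a), N.oppMul_mul_oppMul hb (N.proj_mem i a), smul_mul_assoc,
    superSign_comm]

/-- Conjugating the defining relation by a parity operator changes `R_b` only by a sign, which
occurs on both sides. Thus the parity involution acts on the centralizer and grades it. -/
theorem twist_mem_centralizer (N : NovikovSuperalgebra k V) (i : ZMod 2) {s : Module.End k V}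
    (hs : s ∈ N.centralizer) : N.twist i s ∈ N.centralizer := by
  intro j b hb
  have h := congrArg (fun f => superSign j i • N.twist i f) (hs j b hb)
  simp only [N.twist_mul, N.twist_oppMul hb, smul_mul_assoc, mul_smul_comm, smul_smul,
    superSign_mul_self, one_smul] at h
  rw [h, N.twist_twist, N.twist_twist, add_comm]

/-- The supercommutator `[a ∘ ·, s]` of a left multiplication with an operator. -/
noncomputable def lieOp (N : NovikovSuperalgebra k V) :
    V →ₗ[k] Module.End k V →ₗ[k] Module.End k V :=
  ∑ i, ((LinearMap.mul k (Module.End k V)).compl₁₂ (N.mul ∘ₗ N.proj i) LinearMap.id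
    - (LinearMap.mul k (Module.End k V)).flip.compl₁₂ (N.mul ∘ₗ N.proj i) (N.twist i))

theorem lieOp_of_mem (N : NovikovSuperalgebra k V) {i : ZMod 2} {a : V} (ha : a ∈ N.grading i)
    (s : Module.End k V) :
    N.lieOp a s = (N.mul a * s : Module.End k V) - (N.twist i s * N.mul a : Module.End k V) := by
  simp only [lieOp, LinearMap.sum_apply, LinearMap.sub_apply, LinearMap.compl₁₂_apply,
    LinearMap.comp_apply, LinearMap.flip_apply, N.proj_of_mem ha]
  rw [Finset.sum_eq_single i]
  · simp
  · intro b _ hb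
    rw [if_neg hb.symm]
    simp only [map_zero, LinearMap.zero_apply, sub_zero]
  · simp

/-- The product `(-1) ^ (|a| |s|) s a`. -/
noncomputable def evalOp (N : NovikovSuperalgebra k V) : V →ₗ[k] Module.End k V →ₗ[k] V :=
  ∑ i, (LinearMap.id (R := k) (M := Module.End k V)).flip.compl₁₂ (N.proj i) (N.twist i)

theorem evalOp_of_mem (N : NovikovSuperalgebra k V) {i : ZMod 2} {a : V} (ha : a ∈ N.grading i)
    (s : Module.End k V) : N.evalOp a s = N.twist i s a := by
  simp only [evalOp, LinearMap.sum_apply, LinearMap.compl₁₂_apply,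
    LinearMap.flip_apply, N.proj_of_mem ha]
  rw [Finset.sum_eq_single i]
  · simp
  · intro b _ hb
    rw [if_neg hb.symm, map_zero]
  · simp

/-- This produces `a ∘ 1 = a` in the extension, the source of faithfulness. -/
theorem evalOp_one (N : NovikovSuperalgebra k V) (a : V) : N.evalOp a 1 = a := by
  have : N.evalOp.flip 1 = LinearMap.id := by
    refine N.hom_ext_of_mem fun i a ha => ?_
    rw [LinearMap.flip_apply, N.evalOp_of_mem ha, N.twist_one]
    rfl
  exact LinearMap.congr_fun this a

/-- By the super Jacobi identity, the supercommutator of `R_b` with `[L_a, s]` reduces to those of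
`s` with `R_b` and with `[L_a, R_b] = R_{a∘b} - R_a R_b`; both vanish. -/
theorem lieOp_mem_centralizer (N : NovikovSuperalgebra k V) (a : V) {s : Module.End k V}
    (hs : s ∈ N.centralizer) : N.lieOp a s ∈ N.centralizer := by
  rw [← N.sum_proj a, map_sum, LinearMap.sum_apply]
  refine Submodule.sum_mem _ fun i _ => ?_
  generalize N.proj i a = a', N.proj_mem i a = ha
  intro j b hb
  rw [N.lieOp_of_mem ha, map_sub, N.twist_mul, N.twist_mul, N.twist_mulLeft ha]
  -- `R_{a∘b}` and `R_a R_b` both have parity `i + j`, so moving either past `t` costs the same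
  -- twist.
  have hQ : ∀ t ∈ N.centralizer,
      ((N.oppMul (N.mul a' b) - N.oppMul a' * N.oppMul b) * t : Module.End k V) =
        N.twist i (N.twist j t) * (N.oppMul (N.mul a' b) - N.oppMul a' * N.oppMul b) := by
    intro t ht
    rw [sub_mul, ht _ _ (N.mul_mem ha hb), mul_assoc, ht _ _ hb, ← mul_assoc,
      N.twist_mem_centralizer j ht _ _ ha, N.twist_twist, mul_sub, mul_assoc]
  have h1 := N.mulLeft_mul_oppMul ha hb
  have h2 := hQ s hs
  rw [← h1] at h2
  have h3 := hs j b hb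
  have h4 := N.twist_mem_centralizer i hs j b hb
  rw [N.twist_twist, add_comm j i, ← N.twist_twist] at h4 ⊢
  have h5 := congrArg (fun f => (N.mul a' * f : Module.End k V)) h3
  have h6 := congrArg (fun f => (f * N.mul a' : Module.End k V)) h4
  rcases superSign_eq i j with hp | hp <;> simp only [hp] at h2 h5 h6 ⊢
  · linear_combination (norm := noncomm_ring) -h2 + h5 - h6
  · linear_combination (norm := noncomm_ring) h2 - h5 - h6

end NovikovSuperalgebra

namespace NovikovSuperalgebra

variable {k : Type u} {V : Type v} [Field k] [AddCommGroup V] [Module k V]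

/-! ### The extension of a Novikov superalgebra by a faithful bimodule -/

/-- The product on `V × V × N.centralizer`, the null extension of `V` by a bimodule in which
the operator `1` satisfies `a ∘ 1 = a`. -/
noncomputable def extMul (N : NovikovSuperalgebra k V) :
    V × V × N.centralizer →ₗ[k] V × V × N.centralizer →ₗ[k] V × V × N.centralizer :=
  LinearMap.mk₂ k
    -- An operator acted on from the left contributes to both module summands: its value at `x.1`
    -- and its supercommutator with `L_{x.1}`. Acted on from the right, it stays in the centralizer.
    (fun x y => (N.mul x.1 y.1, N.mul x.1 y.2.1 + N.mul x.2.1 y.1 + N.evalOp x.1 y.2.2,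
      ⟨N.lieOp x.1 y.2.2 + (x.2.2 : Module.End k V) * N.oppMul y.1,
        add_mem (N.lieOp_mem_centralizer _ y.2.2.2)
          (N.mul_mem_centralizer x.2.2.2 (N.oppMul_mem_centralizer _))⟩))
    (fun x x' y => by
      refine Prod.ext ?_ (Prod.ext ?_ (Subtype.ext ?_))
      · simp
      · simp; abel
      · simp [add_mul]; abel)
    (fun c x y => by
      refine Prod.ext ?_ (Prod.ext ?_ (Subtype.ext ?_))
      · simp
      · simp
      · simp)
    (fun x y y' => by
      refine Prod.ext ?_ (Prod.ext ?_ (Subtype.ext ?_))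
      · simp
      · simp; abel
      · simp [mul_add]; abel)
    (fun c x y => by
      refine Prod.ext ?_ (Prod.ext ?_ (Subtype.ext ?_))
      · simp
      · simp
      · simp)

theorem extMul_fst (N : NovikovSuperalgebra k V) (x y : V × V × N.centralizer) :
    (N.extMul x y).1 = N.mul x.1 y.1 := rfl

theorem extMul_snd_fst (N : NovikovSuperalgebra k V) (x y : V × V × N.centralizer) :
    (N.extMul x y).2.1 = N.mul x.1 y.2.1 + N.mul x.2.1 y.1 + N.evalOp x.1 y.2.2 := rfl

theorem extMul_snd_snd (N : NovikovSuperalgebra k V) (x y : V × V × N.centralizer) :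
    ((N.extMul x y).2.2 : Module.End k V) =
      N.lieOp x.1 y.2.2 + (x.2.2 : Module.End k V) * N.oppMul y.1 := rfl

/-- The involution whose eigenspaces are the components of the extension. -/
noncomputable def extParity (N : NovikovSuperalgebra k V) :
    Module.End k (V × V × N.centralizer) :=
  (N.parity 1).prodMap ((N.parity 1).prodMap
    ((N.twist 1).restrict fun _ hs => N.twist_mem_centralizer 1 hs))

theorem extParity_extParity (N : NovikovSuperalgebra k V) (x : V × V × N.centralizer) :
    N.extParity (N.extParity x) = x := by
  refine Prod.ext ?_ (Prod.ext ?_ (Subtype.ext ?_))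
  · exact N.parity_parity 1 _
  · exact N.parity_parity 1 _
  · exact N.twist_twist_self 1 _

/-- An operator is homogeneous of parity `i`. -/
def IsHomogeneousOp (N : NovikovSuperalgebra k V) (i : ZMod 2) (f : Module.End k V) : Prop :=
  ∀ j, N.twist j f = superSign i j • f

theorem isHomogeneousOp_iff (N : NovikovSuperalgebra k V) {i : ZMod 2} {f : Module.End k V} :
    N.IsHomogeneousOp i f ↔ N.twist 1 f = superSign i 1 • f := by
  refine ⟨fun h => h 1, fun h j => ?_⟩
  fin_cases j
  -- `0 = 1 + 1` in `ZMod 2`, so the twist by `0` is the square of the involution `N.twist 1`.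
  · have h0 : N.twist 0 f = f := by
      have h11 := N.twist_twist 1 1 f
      rw [N.twist_twist_self, show (1 + 1 : ZMod 2) = 0 by decide] at h11
      exact h11.symm
    have h1 : superSign i 0 = 1 := by simp [superSign]
    have h2 : N.twist 0 f = superSign i 0 • f := by rw [h0, h1, one_smul]
    exact h2
  · exact h

theorem IsHomogeneousOp.mul {N : NovikovSuperalgebra k V} {i j : ZMod 2} {f g : Module.End k V}
    (hf : N.IsHomogeneousOp i f) (hg : N.IsHomogeneousOp j g) :
    N.IsHomogeneousOp (i + j) (f * g) := by
  intro l
  rw [N.twist_mul, hf, hg, smul_mul_assoc, mul_smul_comm, smul_smul, superSign_add_left]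

theorem IsHomogeneousOp.apply_mem [CharZero k] {N : NovikovSuperalgebra k V} {i j : ZMod 2}
    {f : Module.End k V} (hf : N.IsHomogeneousOp i f) {a : V} (ha : a ∈ N.grading j) :
    f a ∈ N.grading (i + j) := by
  rw [N.mem_grading_iff]
  have h := LinearMap.congr_fun (hf 1) (N.parity 1 a)
  rw [twist_apply, Module.End.mul_apply, Module.End.mul_apply, N.parity_parity,
    N.parity_of_mem ha] at h
  rw [h, superSign_add_left, LinearMap.smul_apply, map_zsmul, smul_smul]

theorem evalOp_of_homogeneous {N : NovikovSuperalgebra k V} {i j : ZMod 2} {a : V}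
    {s : Module.End k V} (ha : a ∈ N.grading i) (hs : N.IsHomogeneousOp j s) :
    N.evalOp a s = superSign i j • s a := by
  rw [N.evalOp_of_mem ha, hs, LinearMap.smul_apply, superSign_comm]

theorem lieOp_of_homogeneous {N : NovikovSuperalgebra k V} {i j : ZMod 2} {a : V}
    {s : Module.End k V} (ha : a ∈ N.grading i) (hs : N.IsHomogeneousOp j s) :
    N.lieOp a s = (N.mul a * s : Module.End k V)
      - superSign i j • (s * N.mul a : Module.End k V) := by
  rw [N.lieOp_of_mem ha, hs, smul_mul_assoc, superSign_comm]

theorem IsHomogeneousOp.lieOp {N : NovikovSuperalgebra k V} {i j : ZMod 2} {a : V}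
    {s : Module.End k V} (ha : a ∈ N.grading i) (hs : N.IsHomogeneousOp j s) :
    N.IsHomogeneousOp (i + j) (N.lieOp a s) := by
  intro l
  rw [lieOp_of_homogeneous ha hs, map_sub, map_zsmul,
    (IsHomogeneousOp.mul (fun m => N.twist_mulLeft ha m) hs) l,
    (hs.mul (fun m => N.twist_mulLeft ha m)) l, add_comm j i, smul_sub, smul_comm]

theorem oppMul_mul_of_mem_centralizer {N : NovikovSuperalgebra k V} {i j : ZMod 2} {b : V}
    {s : Module.End k V} (hb : b ∈ N.grading j) (hs : s ∈ N.centralizer)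
    (hs' : N.IsHomogeneousOp i s) :
    (N.oppMul b * s : Module.End k V) = superSign i j • (s * N.oppMul b : Module.End k V) := by
  rw [hs j b hb, hs', smul_mul_assoc]

theorem mem_extGrading [CharZero k] (N : NovikovSuperalgebra k V) {i : ZMod 2}
    {x : V × V × N.centralizer} :
    x ∈ signEigenspace N.extParity i ↔ x.1 ∈ N.grading i ∧ x.2.1 ∈ N.grading i ∧
      N.IsHomogeneousOp i x.2.2 := by
  rw [mem_signEigenspace, Prod.ext_iff, Prod.ext_iff, Subtype.ext_iff, N.mem_grading_iff,
    N.mem_grading_iff, N.isHomogeneousOp_iff]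
  rfl

theorem extMul_mem [CharZero k] (N : NovikovSuperalgebra k V) {i j : ZMod 2}
    {x y : V × V × N.centralizer} (hx : x ∈ signEigenspace N.extParity i)
    (hy : y ∈ signEigenspace N.extParity j) :
    N.extMul x y ∈ signEigenspace N.extParity (i + j) := by
  rw [mem_extGrading] at *
  obtain ⟨ha, hv, hr⟩ := hx
  obtain ⟨hb, hw, hs⟩ := hy
  rw [extMul_fst, extMul_snd_fst, extMul_snd_snd, evalOp_of_homogeneous ha hs]
  refine ⟨N.mul_mem ha hb, add_mem (add_mem (N.mul_mem ha hw) (N.mul_mem hv hb))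
    (zsmul_mem (add_comm j i ▸ hs.apply_mem ha) _), fun l => ?_⟩
  rw [map_add, IsHomogeneousOp.lieOp ha hs l, hr.mul (fun m => N.twist_oppMul hb m) l, smul_add]

/-- Beyond right commutativity in `V`, two exchanges are needed: `t(a ∘ b)` equals `t(a) ∘ b` up to
sign, because `t` supercommutes with `R_b`; and `[L_{a∘b}, t]` equals `[L_a, t] R_b` up to sign,
because `L_{a∘b} = ± R_b L_a` and `R_b` supercommutes with `t` and with `[L_a, t]`. -/
theorem extMul_right_comm [CharZero k] (N : NovikovSuperalgebra k V) {i j l : ZMod 2}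
    {x y z : V × V × N.centralizer} (hx : x ∈ signEigenspace N.extParity i)
    (hy : y ∈ signEigenspace N.extParity j) (hz : z ∈ signEigenspace N.extParity l) :
    N.extMul (N.extMul x y) z = superSign j l • N.extMul (N.extMul x z) y := by
  rw [mem_extGrading] at *
  obtain ⟨a, v, r, hr⟩ := x
  obtain ⟨b, w, s, hs⟩ := y
  obtain ⟨c, u, t, ht⟩ := z
  obtain ⟨ha, hv, hr'⟩ := hx
  obtain ⟨hb, hw, hs'⟩ := hy
  obtain ⟨hc, hu, ht'⟩ := hz
  simp only at ha hv hr' hb hw hs' hc hu ht'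
  refine Prod.ext ?_ (Prod.ext ?_ (Subtype.ext ?_))
  · exact N.right_comm ha hb hc
  · simp only [Prod.smul_snd, Prod.smul_fst, extMul_fst, extMul_snd_fst,
      evalOp_of_homogeneous ha hs', evalOp_of_homogeneous ha ht',
      evalOp_of_homogeneous (N.mul_mem ha hb) ht', evalOp_of_homogeneous (N.mul_mem ha hc) hs',
      map_add, map_zsmul, LinearMap.add_apply, LinearMap.smul_apply]
    have h1 := N.right_comm ha hb hu
    have h2 := N.right_comm ha hw hc
    have h3 := N.right_comm hv hb hc
    have h4 := LinearMap.congr_fun (oppMul_mul_of_mem_centralizer hb ht ht') a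
    have h5 := LinearMap.congr_fun (oppMul_mul_of_mem_centralizer hc hs hs') a
    simp only [Module.End.mul_apply, LinearMap.smul_apply, N.oppMul_of_mem hb ha, map_zsmul,
      N.oppMul_of_mem hc ha, N.oppMul_of_mem hb (ht'.apply_mem ha),
      N.oppMul_of_mem hc (hs'.apply_mem ha), superSign_add_left, superSign_add_right,
      superSign_comm j i, superSign_comm l i, superSign_comm l j] at h4 h5 ⊢
    rcases superSign_eq i j with hp | hp <;> rcases superSign_eq i l with hq | hq <;>
      rcases superSign_eq j l with hr | hr <;> simp only [hp, hq, hr] at h1 h2 h3 h4 h5 ⊢ <;>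
      grind
  · simp only [Prod.smul_snd, AddSubgroupClass.coe_zsmul, extMul_fst, extMul_snd_snd]
    have e1 := oppMul_mul_of_mem_centralizer hb (N.lieOp_mem_centralizer a ht)
      (IsHomogeneousOp.lieOp ha ht')
    have e2 := oppMul_mul_of_mem_centralizer hc (N.lieOp_mem_centralizer a hs)
      (IsHomogeneousOp.lieOp ha hs')
    have e3 := oppMul_mul_of_mem_centralizer hb ht ht'
    have e4 := oppMul_mul_of_mem_centralizer hc hs hs'
    have e5 := N.oppMul_mul_oppMul hb hc
    rw [lieOp_of_homogeneous (N.mul_mem ha hb) ht', lieOp_of_homogeneous (N.mul_mem ha hc) hs',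
      N.mulLeft_mul ha hb, N.mulLeft_mul ha hc]
    rw [lieOp_of_homogeneous ha ht'] at e1 ⊢
    rw [lieOp_of_homogeneous ha hs'] at e2 ⊢
    simp only [superSign_add_left, superSign_comm l j] at *
    have e3' := congrArg (fun f => (f * N.mul a : Module.End k V)) e3
    have e4' := congrArg (fun f => (f * N.mul a : Module.End k V)) e4
    have e5' := congrArg (fun f => (r * f : Module.End k V)) e5
    rcases superSign_eq i j with hp | hp <;> rcases superSign_eq i l with hq | hq <;>
      rcases superSign_eq j l with hr | hr <;>
      simp only [hp, hq, hr, one_smul, neg_smul, mul_one, mul_neg, neg_mul, mul_sub, sub_mul,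
        add_mul, neg_neg, ← mul_assoc]
        at e1 e2 e3' e4' e5' ⊢ <;>
      grind

/-- The terms in `t` are supersymmetric under exchanging `a` and `b`: for the values of `t` by
inspection, for the operators by `[[L_a, L_b], t] = [L_{[a,b]}, t]`. The terms in `s` and `r` are
treated in the two steps below. -/
theorem extMul_left_symm [CharZero k] (N : NovikovSuperalgebra k V) {i j l : ZMod 2}
    {x y z : V × V × N.centralizer} (hx : x ∈ signEigenspace N.extParity i)
    (hy : y ∈ signEigenspace N.extParity j) (hz : z ∈ signEigenspace N.extParity l) :
    N.extMul (N.extMul x y) z - N.extMul x (N.extMul y z) =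
      superSign i j • (N.extMul (N.extMul y x) z - N.extMul y (N.extMul x z)) := by
  rw [mem_extGrading] at *
  obtain ⟨a, v, r, hr⟩ := x
  obtain ⟨b, w, s, hs⟩ := y
  obtain ⟨c, u, t, ht⟩ := z
  obtain ⟨ha, hv, hr'⟩ := hx
  obtain ⟨hb, hw, hs'⟩ := hy
  obtain ⟨hc, hu, ht'⟩ := hz
  simp only at ha hv hr' hb hw hs' hc hu ht'
  refine Prod.ext ?_ (Prod.ext ?_ (Subtype.ext ?_))
  · exact N.left_symm ha hb hc
  · simp only [Prod.smul_snd, Prod.smul_fst, Prod.fst_sub, Prod.snd_sub, extMul_fst,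
      extMul_snd_fst, extMul_snd_snd, map_add, LinearMap.add_apply]
    have h1 := N.left_symm ha hb hu
    have h2 := N.left_symm ha hw hc
    have h3 := N.left_symm hv hb hc
    -- `s(a) ∘ c` cancels against the value of `s R_c` at `a`, and likewise for `r` and `b`.
    have h4 := LinearMap.congr_fun (oppMul_mul_of_mem_centralizer hc hs hs') a
    have h5 := LinearMap.congr_fun (oppMul_mul_of_mem_centralizer hc hr hr') b
    have o : ∀ {m : ZMod 2} {q : V}, q ∈ N.grading m → N.IsHomogeneousOp m (N.oppMul q) :=
      fun hq => N.twist_oppMul hq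
    rw [evalOp_of_homogeneous ha (IsHomogeneousOp.lieOp hb ht'),
      evalOp_of_homogeneous hb (IsHomogeneousOp.lieOp ha ht')]
    simp only [Module.End.mul_apply, LinearMap.smul_apply, LinearMap.sub_apply,
      N.oppMul_of_mem hc ha, N.oppMul_of_mem hc hb, map_zsmul,
      N.oppMul_of_mem hc (hs'.apply_mem ha), N.oppMul_of_mem hc (hr'.apply_mem hb),
      evalOp_of_homogeneous ha hs', evalOp_of_homogeneous hb hr',
      evalOp_of_homogeneous ha ht', evalOp_of_homogeneous hb ht',
      evalOp_of_homogeneous (N.mul_mem ha hb) ht', evalOp_of_homogeneous (N.mul_mem hb ha) ht',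
      evalOp_of_homogeneous ha (hs'.mul (o hc)), evalOp_of_homogeneous hb (hr'.mul (o hc)),
      lieOp_of_homogeneous ha ht', lieOp_of_homogeneous hb ht',
      superSign_add_left, superSign_add_right,
      superSign_comm j i, superSign_comm l i, superSign_comm l j] at h1 h2 h3 h4 h5 ⊢
    rcases superSign_eq i j with hp | hp <;> rcases superSign_eq i l with hq | hq <;>
      rcases superSign_eq j l with hr | hr <;> simp only [hp, hq, hr] at h1 h2 h3 h4 h5 ⊢ <;>
      grind
  · simp only [Prod.smul_snd, Prod.snd_sub, AddSubgroupClass.coe_zsmul, Submodule.coe_sub, extMul_fst,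
      extMul_snd_snd, map_add]
    have o : ∀ {m : ZMod 2} {q : V}, q ∈ N.grading m → N.IsHomogeneousOp m (N.oppMul q) :=
      fun hq => N.twist_oppMul hq
    have e1 := N.mulLeft_mul_mulLeft ha hb
    -- `[L_a, s] R_c - [L_a, s R_c]` is `s [L_a, R_c]` up to sign, to be matched with `s (R_a R_c -
    -- R_{a∘c})` from the exchanged associator; `e3` does the same for `r`.
    have e2 := congrArg (fun f => (s * f : Module.End k V)) (N.mulLeft_mul_oppMul ha hc)
    have e3 := congrArg (fun f => (r * f : Module.End k V)) (N.mulLeft_mul_oppMul hb hc)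
    have e1t := congrArg (fun f => (t * f : Module.End k V)) e1
    have e1t' := congrArg (fun f => (f * t : Module.End k V)) e1
    rw [lieOp_of_homogeneous ha (IsHomogeneousOp.lieOp hb ht'),
      lieOp_of_homogeneous hb (IsHomogeneousOp.lieOp ha ht')]
    simp only [lieOp_of_homogeneous ha hs', lieOp_of_homogeneous hb hr',
      lieOp_of_homogeneous ha ht', lieOp_of_homogeneous hb ht',
      lieOp_of_homogeneous (N.mul_mem ha hb) ht', lieOp_of_homogeneous (N.mul_mem hb ha) ht',
      lieOp_of_homogeneous ha (hs'.mul (o hc)), lieOp_of_homogeneous hb (hr'.mul (o hc)),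
      superSign_add_left, superSign_add_right, superSign_comm j i] at e2 e3 e1t e1t' ⊢
    rcases superSign_eq i j with hp | hp <;> rcases superSign_eq i l with hq | hq <;>
      rcases superSign_eq j l with hr | hr <;>
      simp only [hp, hq, hr, one_smul, neg_smul, mul_one, mul_neg, neg_mul, mul_sub, sub_mul,
        add_mul, neg_neg, ← mul_assoc] at e2 e3 e1t e1t' ⊢ <;>
      grind

/-- The null extension of a Novikov superalgebra on `V × V × N.centralizer`. -/
noncomputable def extension [CharZero k] (N : NovikovSuperalgebra k V) :
    NovikovSuperalgebra k (V × V × N.centralizer) where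
  grading := signEigenspace N.extParity
  isInternal := isInternal_signEigenspace N.extParity_extParity
  mul := N.extMul
  mul_mem := N.extMul_mem
  right_comm := N.extMul_right_comm
  left_symm := N.extMul_left_symm

end NovikovSuperalgebra

/-! ### Tensors determined by evaluating the polynomial factor. -/

open Classical in
theorem eq_zero_of_forall_eval_tmul {k : Type u} {V : Type v} [Field k] [CharZero k]
    [AddCommGroup V] [Module k V] {x : k[X] ⊗[k] V}
    (h : ∀ α : k, α ≠ 1 →
      TensorProduct.lid k V ((aeval (R := k) α).toLinearMap.rTensor V x) = 0) : x = 0 := by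
  let b := Module.Basis.ofVectorSpace k V
  refine (TensorProduct.equivFinsuppOfBasisRight b (M := k[X])).injective ?_
  rw [map_zero]
  -- In a basis of `V` the tensor becomes a family of polynomials, each with a root at every `α ≠
  -- 1`; in characteristic zero these are infinitely many.
  ext1 i
  rw [Finsupp.zero_apply]
  have key : ∀ (α : k) (y : k[X] ⊗[k] V),
      b.repr (TensorProduct.lid k V ((aeval (R := k) α).toLinearMap.rTensor V y)) i =
        eval α (TensorProduct.equivFinsuppOfBasisRight b y i) := by
    intro α y
    induction y using TensorProduct.induction_on with
    | zero => simp
    | add y z hy hz => simp only [map_add, Finsupp.add_apply, hy, hz, eval_add]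
    | tmul f a => simp [coe_aeval_eq_eval, mul_comm]
  refine Polynomial.eq_zero_of_infinite_isRoot _ (Set.Infinite.mono (s := {1}ᶜ) ?_
    (Set.finite_singleton (1 : k)).infinite_compl)
  intro α hα
  have := key α x
  rw [h α hα] at this
  simpa using this.symm

/-! ### Restricted adjoint representations and a criterion for faithfulness. -/

namespace GDSuperalgebra

variable {k : Type u} {V : Type v} {W : Type w} [Field k] [AddCommGroup V] [Module k V]
  [AddCommGroup W] [Module k W]

/-- Sesquilinearity reduces this to generators, whose `λ`-bracket is built from the three preserved
operations. -/
theorem baseChange_quadEval (G : GDSuperalgebra k V) (G' : GDSuperalgebra k W) (φ : V →ₗ[k] W)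
    (hmul : ∀ a b, φ (G.mul a b) = G'.mul (φ a) (φ b))
    (hopp : ∀ a b, φ (G.oppMul a b) = G'.oppMul (φ a) (φ b))
    (hbracket : ∀ a b, φ (G.bracket a b) = G'.bracket (φ a) (φ b)) (α : k) (x y : k[X] ⊗[k] V) :
    φ.baseChange k[X] (G.quadEval α x y) =
      G'.quadEval α (φ.baseChange k[X] x) (φ.baseChange k[X] y) := by
  have hf : ∀ (f : k[X]) (a : V), f ⊗ₜ[k] a = f • ((1 : k[X]) ⊗ₜ[k] a) := by
    intro f a; simp [TensorProduct.smul_tmul']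
  induction x using TensorProduct.induction_on with
  | zero => simp
  | add x z hx hz => simp only [map_add, LinearMap.add_apply, hx, hz]
  | tmul f a =>
    induction y using TensorProduct.induction_on with
    | zero => simp
    | add y z hy hz => simp only [map_add, hy, hz]
    | tmul g b =>
      rw [hf f a, hf g b]
      simp only [quadEval_smul_left, quadEval_smul_right, map_smul, LinearMap.baseChange_tmul,
        LinearMap.map_smul_of_tower, quadEval_gen, map_add, hmul, hopp, hbracket]

/-- The adjoint representation of the quadratic Lie conformal superalgebra of `G'`, restricted
along a homomorphism `G → G'`. -/
noncomputable def pullbackAdjoint (G : GDSuperalgebra k V) (G' : GDSuperalgebra k W)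
    (φ : V →ₗ[k] W)
    (hmem : ∀ i, ∀ a ∈ G.grading i, φ a ∈ G'.grading i)
    (hmul : ∀ a b, φ (G.mul a b) = G'.mul (φ a) (φ b))
    (hopp : ∀ a b, φ (G.oppMul a b) = G'.oppMul (φ a) (φ b))
    (hbracket : ∀ a b, φ (G.bracket a b) = G'.bracket (φ a) (φ b)) :
    G.quadraticLie.Representation (k[X] ⊗[k] W) :=
  have hJ : ∀ {i : ZMod 2} {x : k[X] ⊗[k] V}, x ∈ (G.grading i).baseChange k[X] →
      φ.baseChange k[X] x ∈ (G'.grading i).baseChange k[X] := by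
    intro i x hx
    refine baseChange_induction
      (P := fun x => φ.baseChange k[X] x ∈ (G'.grading i).baseChange k[X])
      (fun a ha => ?_) (by simp) (fun x y hx hy => ?_) (fun f x hx => ?_) hx
    · rw [LinearMap.baseChange_tmul]
      exact Submodule.tmul_mem_baseChange_of_mem _ (hmem i a ha)
    · rw [map_add]; exact add_mem hx hy
    · rw [map_smul]; exact Submodule.smul_mem _ _ hx
  { grading := G'.quadraticLie.grading
    isInternal := G'.quadraticLie.isInternal
    act := G'.quadBracket ∘ₗ (φ.baseChange k[X]).restrictScalars k
    act_mem := fun hx hm n => G'.quadBracket_mem (hJ hx) hm n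
    act_del_left := fun x m α => by
      have : φ.baseChange k[X] (del k _ x) = del k _ (φ.baseChange k[X] x) := map_smul _ _ _
      rw [LinearMap.comp_apply, LinearMap.restrictScalars_apply, this]
      exact G'.quadraticLie.bracket_del_left _ m α
    act_del_right := fun x m α => G'.quadraticLie.bracket_del_right _ m α
    jacobi := fun {i j x y} hx hy m α β => by
      -- The Jacobi identity of the larger algebra is exactly the module identity once `[φx_α φy]`
      -- is recognised as the image of `[x_α y]`.
      refine (G'.quadraticLie.jacobi (hJ hx) (hJ hy) m α β).trans ?_
      have h := G.baseChange_quadEval G' φ hmul hopp hbracket α x y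
      change _ = G'.quadEval (α + β) (φ.baseChange k[X] (G.quadEval α x y)) m
      rw [h]
      rfl }

/-- After applying `π`, the term with `∂` disappears; the bracket contributes `1` and the `λ`-term
contributes `α`. The polynomial factor on the left is evaluated at `-α`. -/
theorem baseChange_quadEval_eq_smul (G : GDSuperalgebra k W) (ι : V →ₗ[k] W) (π : W →ₗ[k] V)
    (y : W) (hmul : ∀ a, π (G.mul (ι a) y) = a) (hopp : ∀ a, π (G.oppMul (ι a) y) = 0)
    (hbracket : ∀ a, π (G.bracket (ι a) y) = a) (α : k) (x : k[X] ⊗[k] V) :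
    π.baseChange k[X] (G.quadEval α (ι.baseChange k[X] x) (1 ⊗ₜ y)) =
      (1 + α) • (1 : k[X]) ⊗ₜ[k]
        TensorProduct.lid k V ((aeval (R := k) (-α)).toLinearMap.rTensor V x) := by
  induction x using TensorProduct.induction_on with
  | zero => simp
  | add x z hx hz =>
    simp only [map_add, LinearMap.add_apply, hx, hz, TensorProduct.tmul_add, smul_add]
  | tmul f a =>
    have hf : f ⊗ₜ[k] ι a = f • ((1 : k[X]) ⊗ₜ[k] ι a) := by
      simp [TensorProduct.smul_tmul']
    rw [LinearMap.baseChange_tmul, hf, quadEval_smul_left, quadEval_gen]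
    simp only [LinearMap.map_smul_of_tower, map_add, LinearMap.baseChange_tmul, hmul, hopp,
      hbracket, TensorProduct.tmul_zero, add_zero, LinearMap.rTensor_tmul,
      TensorProduct.lid_tmul, TensorProduct.tmul_smul, AlgHom.toLinearMap_apply,
      coe_aeval_eq_eval]
    module

theorem eq_zero_of_quadBracket_eq_zero [CharZero k] (G : GDSuperalgebra k W) (ι : V →ₗ[k] W)
    (π : W →ₗ[k] V) (y : W) (hmul : ∀ a, π (G.mul (ι a) y) = a)
    (hopp : ∀ a, π (G.oppMul (ι a) y) = 0) (hbracket : ∀ a, π (G.bracket (ι a) y) = a)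
    {x : k[X] ⊗[k] V} (hx : G.quadBracket (ι.baseChange k[X] x) (1 ⊗ₜ y) = 0) : x = 0 := by
  refine eq_zero_of_forall_eval_tmul fun α hα => ?_
  -- Taking `λ = -α` evaluates the polynomial factor at `α`; the scalar becomes `1 - α`, whence the
  -- excluded value `α = 1`.
  have h := G.baseChange_quadEval_eq_smul ι π y hmul hopp hbracket (-α) x
  rw [← quadEval_apply, hx, map_zero, map_zero, neg_neg] at h
  have h1 : (1 + -α) ≠ 0 := by
    rw [← sub_eq_add_neg]; exact sub_ne_zero.2 hα.symm
  -- Evaluation at `0` is a left inverse of `v ↦ 1 ⊗ v`; any other point would serve.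
  have h2 := congrArg
    (fun z => TensorProduct.lid k V ((aeval (R := k) (0 : k)).toLinearMap.rTensor V z))
    ((smul_eq_zero.1 h.symm).resolve_left h1)
  simpa using h2

/-- A sufficient condition for the faithfulness of a restricted adjoint representation. -/
theorem pullbackAdjoint_isFaithful [CharZero k] (G : GDSuperalgebra k V) (G' : GDSuperalgebra k W)
    (φ : V →ₗ[k] W)
    (hmem : ∀ i, ∀ a ∈ G.grading i, φ a ∈ G'.grading i)
    (hmul : ∀ a b, φ (G.mul a b) = G'.mul (φ a) (φ b))
    (hopp : ∀ a b, φ (G.oppMul a b) = G'.oppMul (φ a) (φ b))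
    (hbracket : ∀ a b, φ (G.bracket a b) = G'.bracket (φ a) (φ b))
    (π : W →ₗ[k] V) (y : W) (hmul' : ∀ a, π (G'.mul (φ a) y) = a)
    (hopp' : ∀ a, π (G'.oppMul (φ a) y) = 0) (hbracket' : ∀ a, π (G'.bracket (φ a) y) = a) :
    (G.pullbackAdjoint G' φ hmem hmul hopp hbracket).IsFaithful := fun _ hx =>
  G'.eq_zero_of_quadBracket_eq_zero φ π y hmul' hopp' hbracket' (hx (1 ⊗ₜ y))

end GDSuperalgebra

/-! ### The embedding of `V` in its extension, and faithfulness on `L(E)`. -/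

namespace NovikovSuperalgebra

variable {k : Type u} {V : Type v} [Field k] [AddCommGroup V] [Module k V]

theorem extMul_inl (N : NovikovSuperalgebra k V) (a b : V) :
    N.extMul (a, 0, 0) (b, 0, 0) = (N.mul a b, 0, 0) := by
  refine Prod.ext ?_ (Prod.ext ?_ (Subtype.ext ?_))
  · simp [extMul_fst]
  · simp [extMul_snd_fst]
  · simp [extMul_snd_snd]

theorem extMul_inl_one_snd_fst (N : NovikovSuperalgebra k V) (a : V) :
    (N.extMul (a, 0, 0) (0, 0, ⟨1, N.one_mem_centralizer⟩)).2.1 = a := by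
  simp [extMul_snd_fst, evalOp_one]

variable [CharZero k]

theorem inl_mem_extension (N : NovikovSuperalgebra k V) {i : ZMod 2} {a : V}
    (ha : a ∈ N.grading i) :
    ((a, 0, 0) : V × V × N.centralizer) ∈ N.extension.grading i :=
  N.mem_extGrading.2 ⟨ha, zero_mem _, fun j => by simp⟩

theorem one_mem_extension (N : NovikovSuperalgebra k V) :
    ((0, 0, ⟨1, N.one_mem_centralizer⟩) : V × V × N.centralizer) ∈ N.extension.grading 0 :=
  N.mem_extGrading.2 ⟨zero_mem _, zero_mem _, fun j => by
    rw [N.twist_one]; simp [superSign]⟩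

theorem oppMul_inl (N : NovikovSuperalgebra k V) (a b : V) :
    N.extension.oppMul (a, 0, 0) (b, 0, 0) = (N.oppMul a b, 0, 0) := by
  have : N.extension.oppMul.compl₁₂ (LinearMap.inl k V (V × N.centralizer))
      (LinearMap.inl k V (V × N.centralizer)) =
      N.oppMul.compr₂ (LinearMap.inl k V (V × N.centralizer)) := by
    refine N.hom_ext_of_mem fun i a ha => N.hom_ext_of_mem fun j b hb => ?_
    change N.extension.oppMul (a, 0, 0) (b, 0, 0) = (N.oppMul a b, 0, 0)
    rw [N.extension.oppMul_of_mem (N.inl_mem_extension ha) (N.inl_mem_extension hb),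
      N.oppMul_of_mem ha hb]
    change superSign i j • N.extMul _ _ = _
    rw [extMul_inl]
    simp
  exact LinearMap.congr_fun₂ this a b

/-- `1 ∘ a = R_a` lies entirely in the centralizer summand, so it does not interfere with `a ∘ 1 =
a`. -/
theorem oppMul_inl_one_snd_fst (N : NovikovSuperalgebra k V) (a : V) :
    (N.extension.oppMul (a, 0, 0) (0, 0, ⟨1, N.one_mem_centralizer⟩)).2.1 = 0 := by
  have : LinearMap.fst k V N.centralizer ∘ₗ LinearMap.snd k V (V × N.centralizer) ∘ₗ
      N.extension.oppMul.flip (0, 0, ⟨1, N.one_mem_centralizer⟩) ∘ₗ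
        LinearMap.inl k V (V × N.centralizer) = 0 := by
    refine N.hom_ext_of_mem fun i a ha => ?_
    change (N.extension.oppMul (a, 0, 0) (0, 0, ⟨1, N.one_mem_centralizer⟩)).2.1 = 0
    rw [N.extension.oppMul_of_mem (N.inl_mem_extension ha) N.one_mem_extension]
    change (superSign i 0 • N.extMul (0, 0, ⟨1, N.one_mem_centralizer⟩) (a, 0, 0)).2.1 = 0
    rw [Prod.smul_snd, Prod.smul_fst, extMul_snd_fst]
    simp
  exact LinearMap.congr_fun this a

/-- The representation of `L(V)` on `L(E)`, where `E` is the null extension of `V`. -/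
noncomputable def extensionRep (N : NovikovSuperalgebra k V) :
    N.commutatorGD.quadraticLie.Representation (k[X] ⊗[k] (V × V × N.centralizer)) :=
  N.commutatorGD.pullbackAdjoint N.extension.commutatorGD (LinearMap.inl k V (V × N.centralizer))
    (fun _ _ ha => N.inl_mem_extension ha)
    (fun a b => (N.extMul_inl a b).symm)
    (fun a b => (N.oppMul_inl a b).symm)
    (fun a b => by
      change LinearMap.inl k V (V × N.centralizer) (N.mul a b - N.oppMul a b) =
        N.extMul (a, 0, 0) (b, 0, 0) - N.extension.oppMul (a, 0, 0) (b, 0, 0)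
      rw [map_sub, extMul_inl, oppMul_inl]
      rfl)

theorem extensionRep_isFaithful (N : NovikovSuperalgebra k V) : N.extensionRep.IsFaithful := by
  have h (a : V) : (N.extension.mul (a, 0, 0) (0, 0, ⟨1, N.one_mem_centralizer⟩)
      - N.extension.oppMul (a, 0, 0) (0, 0, ⟨1, N.one_mem_centralizer⟩)).2.1 = a := by
    rw [Prod.snd_sub, Prod.fst_sub, oppMul_inl_one_snd_fst, sub_zero]
    exact N.extMul_inl_one_snd_fst a
  exact N.commutatorGD.pullbackAdjoint_isFaithful N.extension.commutatorGD _ _ _ _ _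
    (LinearMap.fst k V N.centralizer ∘ₗ LinearMap.snd k V (V × N.centralizer))
    (0, 0, ⟨1, N.one_mem_centralizer⟩) N.extMul_inl_one_snd_fst N.oppMul_inl_one_snd_fst h

end NovikovSuperalgebra

theorem mainTheorem2 {k : Type*} [Field k] [CharZero k] {V : Type*} [AddCommGroup V] [Module k V]
    [FiniteDimensional k V] (N : NovikovSuperalgebra k V) :
    N.commutatorGD.quadraticLie.HasFFR :=
  -- The centralizer is a subspace of `End V`, so `E` is finite-dimensional and `H ⊗ E` is finitely
  -- generated over `H`.
  ⟨k[X] ⊗[k] (V × V × N.centralizer), inferInstance, inferInstance, inferInstance, inferInstance,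
    N.extensionRep, inferInstance, N.extensionRep_isFaithful⟩
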